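/- Let $p,q\ge 0$ with $p+q>0$. Let $C[-\infty,+\infty]$ be the space of continuous functions $f:\mathbb R\to\mathbb R$ with finite limits at $\pm\infty$, with the supremum norm. Let $\Delta^*_{p,q}f=f''$, where the domain consists of those $f\in C[-\infty,+\infty]$ that are twice continuously differentiable on $(-\infty,0]$ and on $[0,\infty)$ separately (with one-sided derivatives at $0$), for which $\lim_{x\to\pm\infty}f''(x)$ exist and are finite, and which satisfy $p f'(0+)=q f'(0-)$ and $f''(0+)=f''(0-)$. Let $\Delta_{p,q}$ be the operator in $L^1(\mathbb R)$ with domain consisting of the $\phi\in L^1(\mathbb R)$ for which there are $C,D\in\mathbb R$ and $\psi\in L^1(\mathbb R)$ with $$\phi(x)=qC+Dx-\int_x^0(x-y)\psi(y)\,dy\ \ (x<0),\qquad \phi(x)=pC+Dx+\int_0^x(x-y)\psi(y)\,dy\ \ (x>0)$$ for almost every $x$, and $\Delta_{p,q}\phi=\psi$ (so that $\psi=\phi''$ off $0$, $p\phi(0-)=q\phi(0+)$ and $\phi'(0-)=\phi'(0+)$). For $s\ge0$ and $x\in\mathbb R$ put $$C^*_{p,q}(s)f(x)=\tfrac12\big(f(x+s)+f(x-s)\big)+\begin{cases}0,&|x|\ge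 s,\\ \frac{q-p}{2(p+q)}\big[f(-x-s)-f(x+s)\big],&-s<x\le 0,\\ \frac{p-q}{2(p+q)}\big[f(s-x)-f(x-s)\big],&0<x<s.\end{cases}$$ For $t>0$ define $$\gamma^+_{p,q}(t,x,y)=\begin{cases}\frac1{\sqrt{2\pi t}}\Big(e^{-\frac{(y-x)^2}{2t}}+\frac{p-q}{p+q}e^{-\frac{(y+x)^2}{2t}}\Big),&y>0,\\ \frac1{\sqrt{2\pi t}}\frac{2q}{p+q}e^{-\frac{(y-x)^2}{2t}},&y<0,\end{cases}\qquad \gamma^-_{p,q}(t,x,y)=\begin{cases}\frac1{\sqrt{2\pi t}}\Big(e^{-\frac{(y-x)^2}{2t}}+\frac{q-p}{p+q}e^{-\frac{(y+x)^2}{2t}}\Big),&y<0,\\ \frac1{\sqrt{2\pi t}}\frac{2p}{p+q}e^{-\frac{(y-x)^2}{2t}},&y>0.\end{cases}$$ Then $\frac12\Delta^*_{p,q}$ generates a strongly continuous semigroup $\{e^{t\frac12\Delta^*_{p,q}},\,t\ge0\}$ in $C[-\infty,+\infty]$, $\frac12\Delta_{p,q}$ generates a strongly continuous semigroup $\{e^{t\frac12\Delta_{p,q}},\,t\ge0\}$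 in $L^1(\mathbb R)$, and the following hold for every $t>0$. 1. (Weierstrass formula) For all $f\in C[-\infty,+\infty]$ and $x\in\mathbb R$, $$e^{t\frac12\Delta^*_{p,q}}f(x)=\sqrt{\tfrac{2}{\pi t}}\int_0^\infty e^{-\frac{s^2}{2t}}\,C^*_{p,q}(s)f(x)\,ds .$$ 2. For all $f\in C[-\infty,+\infty]$, $$e^{t\frac12\Delta^*_{p,q}}f(x)=\int_{-\infty}^\infty\gamma^{+}_{p,q}(t,x,y)f(y)\,dy\ \ (x>0),\qquad e^{t\frac12\Delta^*_{p,q}}f(x)=\int_{-\infty}^\infty\gamma^{-}_{p,q}(t,x,y)f(y)\,dy\ \ (x<0).$$ 3. $\gamma^+_{p,q}(t,x,\cdot)$ for $x>0$ and $\gamma^-_{p,q}(t,x,\cdot)$ for $x<0$ are probability densities on $\mathbb R$. If $(w(t))_{t\ge0}$, under laws $(P_x)_{x\in\mathbb R}$ with $P_x(w(0)=x)=1$, is a real-valued Markov process with transition semigroup $e^{t\frac12\Delta^*_{p,q}}$, i.e. $E_x[f(w(s+t))\mid w(r),\,r\le s]=\big(e^{t\frac12\Delta^*_{p,q}}f\big)(w(s))$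 for $s,t\ge0$ and $f\in C[-\infty,+\infty]$ (in particular $E_xf(w(t))=e^{t\frac12\Delta^*_{p,q}}f(x)$), then under $P_x$ the variable $w(t)$ has density $\gamma^+_{p,q}(t,x,\cdot)$ if $x>0$ and $\gamma^-_{p,q}(t,x,\cdot)$ if $x<0$. 4. For every $\phi\in L^1(\mathbb R)$ and almost every $y\in\mathbb R$, $$e^{t\frac12\Delta_{p,q}}\phi(y)=\int_0^\infty\gamma^+_{p,q}(t,x,y)\phi(x)\,dx+\int_{-\infty}^0\gamma^-_{p,q}(t,x,y)\phi(x)\,dx .$$ -/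

import Mathlib

open MeasureTheory Filter Topology Set
open scoped BoundedContinuousFunction

namespace SkewDiffusion

/-- The space `C[-∞,+∞]` of continuous real functions on `ℝ` that have finite limits at `+∞` and
at `-∞` (such functions are bounded), with the supremum norm. -/
def CBar : Submodule ℝ (ℝ →ᵇ ℝ) where
  carrier := {f | (∃ l : ℝ, Tendsto f atTop (𝓝 l)) ∧ ∃ l : ℝ, Tendsto f atBot (𝓝 l)}
  zero_mem' := ⟨⟨0, tendsto_const_nhds⟩, ⟨0, tendsto_const_nhds⟩⟩
  add_mem' := by
    rintro f g ⟨⟨a, ha⟩, ⟨b, hb⟩⟩ ⟨⟨c, hc⟩, ⟨d, hd⟩⟩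
    exact ⟨⟨a + c, ha.add hc⟩, ⟨b + d, hb.add hd⟩⟩
  smul_mem' := by
    rintro k f ⟨⟨a, ha⟩, ⟨b, hb⟩⟩
    exact ⟨⟨k • a, ha.const_smul k⟩, ⟨k • b, hb.const_smul k⟩⟩

section Semigroups

variable {X : Type*} [NormedAddCommGroup X] [NormedSpace ℝ X]

/-- `T` (only its values at `t ≥ 0` matter) is a strongly continuous semigroup of bounded linear
operators on `X`. -/
structure IsC0Semigroup (T : ℝ → X →L[ℝ] X) : Prop where
  zero : T 0 = ContinuousLinearMap.id ℝ X
  add : ∀ s t : ℝ, 0 ≤ s → 0 ≤ t → T (s + t) = (T s).comp (T t)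
  cont : ∀ v : X, ContinuousOn (fun t : ℝ => T t v) (Ici 0)

/-- `T` is a strongly continuous semigroup whose generator is the operator with graph `G`: the
pair `(v, u)` lies in the graph exactly when `(T h v - v) / h → u` in norm as `h → 0+`. -/
structure IsGeneratedBy (T : ℝ → X →L[ℝ] X) (G : X → X → Prop) : Prop where
  semigroup : IsC0Semigroup T
  generator : ∀ v u : X, G v u ↔ Tendsto (fun h : ℝ => h⁻¹ • (T h v - v)) (𝓝[>] 0) (𝓝 u)

/-- The graph of one half of the operator with graph `G`. -/
def Half (G : X → X → Prop) (v u : X) : Prop := ∃ u' : X, G v u' ∧ u = (1 / 2 : ℝ) • u'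

end Semigroups

/-- The graph of `Δ_{p,q}` in `L¹(ℝ)`: `Delta p q φ ψ` says that `φ` belongs to the domain and that
`Δ_{p,q} φ = ψ` (`ψ` is the second derivative of `φ` off `0`, the one-sided limits at `0` satisfy
`p φ(0-) = q φ(0+)`, and `φ'(0-) = φ'(0+)`). -/
def Delta (p q : ℝ) (φ ψ : Lp ℝ 1 (volume : Measure ℝ)) : Prop :=
  ∃ C D : ℝ,
    (∀ᵐ x : ℝ, x < 0 → φ x = q * C + D * x - ∫ y in x..0, (x - y) * ψ y) ∧
    (∀ᵐ x : ℝ, 0 < x → φ x = p * C + D * x + ∫ y in (0 : ℝ)..x, (x - y) * ψ y)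

/-- The graph of `Δ*_{p,q}` in `C[-∞,+∞]`: `f` is twice continuously differentiable on `(-∞,0]` and
on `[0,∞)` separately, `p f'(0+) = q f'(0-)`, and `f'' = g` on both half-lines, up to and including
`0` from either side. That `g` lies in `C[-∞,+∞]` says that `f''(0-) = f''(0+)` and that
`f''` has finite limits at `±∞`. -/
def DualDelta (p q : ℝ) (f g : CBar) : Prop :=
  ContDiffOn ℝ 2 f.1 (Iic 0) ∧ ContDiffOn ℝ 2 f.1 (Ici 0) ∧
  p * derivWithin f.1 (Ici 0) 0 = q * derivWithin f.1 (Iic 0) 0 ∧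
  (∀ x ≤ 0, iteratedDerivWithin 2 f.1 (Iic 0) x = g.1 x) ∧
  (∀ x ≥ 0, iteratedDerivWithin 2 f.1 (Ici 0) x = g.1 x)

/-- The dual cosine family `C*_{p,q}(s) f (x)`, for `s ≥ 0`. -/
noncomputable def dualCosine (p q s : ℝ) (f : ℝ → ℝ) (x : ℝ) : ℝ :=
  if s ≤ |x| then (f (x + s) + f (x - s)) / 2
  else if x ≤ 0 then
    (f (x + s) + f (x - s)) / 2 + (q - p) / (2 * (p + q)) * (f (-x - s) - f (x + s))
  else
    (f (x + s) + f (x - s)) / 2 + (p - q) / (2 * (p + q)) * (f (s - x) - f (x - s))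

/-- The kernel `γ⁺_{p,q}(t,x,y)`, used for `x > 0`; its value at the single point `y = 0` is
immaterial. -/
noncomputable def gammaPlus (p q t x y : ℝ) : ℝ :=
  if 0 < y then
    1 / √(2 * Real.pi * t) * (Real.exp (-(y - x) ^ 2 / (2 * t))
      + (p - q) / (p + q) * Real.exp (-(y + x) ^ 2 / (2 * t)))
  else 1 / √(2 * Real.pi * t) * (2 * q / (p + q)) * Real.exp (-(y - x) ^ 2 / (2 * t))

/-- The kernel `γ⁻_{p,q}(t,x,y)`, used for `x < 0`; its value at the single point `y = 0` is
immaterial. -/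
noncomputable def gammaMinus (p q t x y : ℝ) : ℝ :=
  if y < 0 then
    1 / √(2 * Real.pi * t) * (Real.exp (-(y - x) ^ 2 / (2 * t))
      + (q - p) / (p + q) * Real.exp (-(y + x) ^ 2 / (2 * t)))
  else 1 / √(2 * Real.pi * t) * (2 * p / (p + q)) * Real.exp (-(y - x) ^ 2 / (2 * t))

/-- `γ_{p,q}(t,x,y)`: `γ⁺` for a start `x > 0` and `γ⁻` for a start `x < 0`
(the value at `x = 0` is never used). -/
noncomputable def gamma (p q t x y : ℝ) : ℝ :=
  if 0 < x then gammaPlus p q t x y else gammaMinus p q t x y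

/-- `(w t)_{t ≥ 0}`, under the family of laws `(P x)_{x ∈ ℝ}`, is a real-valued Markov process with
transition semigroup `S`: under `P x` it starts at `x`, and
`E_x[f(w(s+t)) | w(r), r ≤ s] = (S t f)(w(s))` almost surely. In particular
`E_x f(w(t)) = S t f x`. -/
structure IsMarkovProcess {Ω : Type*} [MeasurableSpace Ω] (S : ℝ → CBar →L[ℝ] CBar)
    (P : ℝ → Measure Ω) (w : ℝ → Ω → ℝ) : Prop where
  prob : ∀ x, IsProbabilityMeasure (P x)
  meas : ∀ t, 0 ≤ t → Measurable (w t)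
  start : ∀ x, ∀ᵐ ω ∂(P x), w 0 ω = x
  markov : ∀ (x s t : ℝ), 0 ≤ s → 0 ≤ t → ∀ f : CBar,
    (P x)[fun ω => f.1 (w (s + t) ω) |
        ⨆ r ∈ Icc (0 : ℝ) s, MeasurableSpace.comap (w r) inferInstance]
      =ᵐ[P x] fun ω => (S t f).1 (w s ω)

end SkewDiffusion

open SkewDiffusion

/-! Both semigroups are heat semigroups in disguise. On `C[-∞,+∞]` let `N f(x) = f(|x|) - f(-|x|)`.
The function `N f` is even and `N` annihilates even functions, so `N² = 0` and `A_k = 1 + kN` is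
invertible with inverse `A_{-k}`. Conjugating the translations `T_s` gives a bounded strongly
continuous group `U_s = A_k T_s A_{-k}`. For `h` of class `C²`, the function `f = A_k h` has
one-sided derivatives `f'(0+) = (1 + 2k) h'(0)` and `f'(0-) = (1 - 2k) h'(0)`. The choice `k = (q -
p) / (2(p + q))` makes these factors `2q/(p + q)` and `2p/(p + q)`, which is exactly the
transmission condition `p f'(0+) = q f'(0-)`. So `Δ*` is the square of the generator of `U`, the
dual cosine family is `(U_s + U_{-s}) / 2` (`dualCosine_eq`), and the semigroup of `½Δ*` is the
average of `U_s` over a centred Gaussian of variance `t`. Folding this average onto `s > 0` is the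
Weierstrass formula; moving `A_{-k}` from the function to the Gaussian gives the kernels `γ±`.

In `L¹` the same is done with the transposed operator `φ ↦ φ + k sgn(x) (φ(x) + φ(-x))`; here the
perturbation produces odd functions and annihilates them.

The generator is identified abstractly in `IsBoundedGroup.isGeneratedBy_gaussian`. A second-order
Taylor expansion shows that Gaussian averages differentiate to half the second derivative along the
group, and Laplace transforms of orbits show that `1 - ½B²` is onto, where `B` generates the group.
An operator that extends `½B²` and has no eigenvector for the eigenvalue `1` must then be the
generator. For the two Laplacians this injectivity is the fact that a solution of `z'' = 2z` which
does not blow up is a decaying exponential on each half-line, and the conditions at `0` force it to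
vanish. Finally `IsGeneratedBy.eq_of_bounded` carries all formulas over to an arbitrary semigroup
with the given generator. -/

namespace SkewDiffusion

/-! ### Semigroups and their generators: uniqueness and identification -/

section Generators

variable {X : Type*} [NormedAddCommGroup X] [NormedSpace ℝ X]
  {T S : ℝ → X →L[ℝ] X} {G : X → X → Prop} {v u : X} {M : ℝ}

/-- Orbits of vectors in the domain of the generator have right derivatives. -/
theorem IsC0Semigroup.hasDerivWithinAt (hT : IsC0Semigroup T)
    (h : Tendsto (fun h : ℝ => h⁻¹ • (T h v - v)) (𝓝[>] 0) (𝓝 u)) {t : ℝ} (ht : 0 ≤ t) :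
    HasDerivWithinAt (fun s => T s v) (T t u) (Ici t) t := by
  rw [← hasDerivWithinAt_Ioi_iff_Ici,
    hasDerivWithinAt_iff_tendsto_slope' self_notMem_Ioi]
  have h1 : Tendsto (fun r : ℝ => r - t) (𝓝[>] t) (𝓝[>] 0) := by
    refine tendsto_nhdsWithin_iff.2 ⟨?_, ?_⟩
    · have : Tendsto (fun r : ℝ => r - t) (𝓝 t) (𝓝 (t - t)) := by
        exact (continuous_id.sub continuous_const).tendsto t
      rw [sub_self] at this
      exact this.mono_left nhdsWithin_le_nhds
    · filter_upwards [self_mem_nhdsWithin] with r hr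
      exact sub_pos.2 (mem_Ioi.1 hr)
  have h2 := ((T t).continuous.tendsto u).comp (h.comp h1)
  refine h2.congr' ?_
  filter_upwards [self_mem_nhdsWithin] with r hr
  have hr' : 0 ≤ r - t := (sub_pos.2 (mem_Ioi.1 hr)).le
  have := congrArg (fun L => L v) (hT.add t (r - t) ht hr')
  simp only [add_sub_cancel, ContinuousLinearMap.comp_apply] at this
  simp [slope_def_module, this]

theorem IsC0Semigroup.tendsto_generator_apply (hT : IsC0Semigroup T)
    (h : Tendsto (fun h : ℝ => h⁻¹ • (T h v - v)) (𝓝[>] 0) (𝓝 u)) {t : ℝ} (ht : 0 ≤ t) :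
    Tendsto (fun h : ℝ => h⁻¹ • (T h (T t v) - T t v)) (𝓝[>] 0) (𝓝 (T t u)) := by
  refine (((T t).continuous.tendsto u).comp h).congr' ?_
  filter_upwards [self_mem_nhdsWithin] with r hr
  have hr' : 0 ≤ r := le_of_lt hr
  have h1 := congrArg (fun L => L v) (hT.add t r ht hr')
  have h2 := congrArg (fun L => L v) (hT.add r t hr' ht)
  rw [add_comm r t] at h2
  simp only [ContinuousLinearMap.comp_apply] at h1 h2
  simp [← h1, ← h2]

/-- Strong continuity together with a uniform bound gives joint continuity: split `A r (y r)` into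
`A r (y r - y t)`, which is controlled by the bound, and `A r (y t)`. -/
theorem continuousOn_comp_of_bounded {s : Set ℝ} {A : ℝ → X →L[ℝ] X} {y : ℝ → X}
    (hA : ∀ t ∈ s, ‖A t‖ ≤ M) (hAc : ∀ v, ContinuousOn (fun t => A t v) s)
    (hy : ContinuousOn y s) : ContinuousOn (fun t => A t (y t)) s := by
  intro t ht
  have h1 : Tendsto (fun r => A r (y r - y t)) (𝓝[s] t) (𝓝 0) := by
    have h2 : Tendsto (fun r => M * ‖y r - y t‖) (𝓝[s] t) (𝓝 0) := by
      have h3 : Tendsto (fun r => y r - y t) (𝓝[s] t) (𝓝 (y t - y t)) :=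
        (hy t ht).sub tendsto_const_nhds
      rw [sub_self] at h3
      simpa using h3.norm.const_mul M
    refine squeeze_zero_norm' ?_ h2
    filter_upwards [self_mem_nhdsWithin] with r hr
    exact (A r).le_of_opNorm_le (hA r hr) _
  have h4 := h1.add (hAc (y t) t ht)
  rw [zero_add] at h4
  refine h4.congr fun r => ?_
  simp

/-- An orbit of a vector in the common domain is the same for two semigroups with the same
generator, one of which is bounded. -/
theorem eq_on_domain (hS : IsGeneratedBy S G) (hT : IsGeneratedBy T G)
    (hM : ∀ t, 0 ≤ t → ‖S t‖ ≤ M) (h : G v u) {t : ℝ} (ht : 0 ≤ t) : T t v = S t v := by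
  have hTv := (hT.generator v u).1 h
  -- The curve `s ↦ S (t - s) (T s v)` joins `S t v` to `T t v`; it is shown to have right
  -- derivative zero.
  have hc : ContinuousOn (fun s => S (t - s) (T s v)) (Icc 0 t) := by
    refine continuousOn_comp_of_bounded (M := M) (A := fun s => S (t - s))
      (fun s hs => hM _ (by linarith [hs.2])) (fun w => ?_)
      ((hT.semigroup.cont v).mono Icc_subset_Ici_self)
    exact (hS.semigroup.cont w).comp (by fun_prop) fun s hs => by
      simp only [mem_Ici]; linarith [hs.2]
  have hd : ∀ s ∈ Ico 0 t, HasDerivWithinAt (fun s => S (t - s) (T s v)) 0 (Ici s) s := by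
    intro s hs
    have e1 := hT.semigroup.hasDerivWithinAt hTv hs.1
    have hg := (hS.generator _ _).1 ((hT.generator _ _).2
      (hT.semigroup.tendsto_generator_apply hTv hs.1))
    have e2 : HasDerivWithinAt (fun r => S (r - s) (T s v)) (T s u) (Ici s) s := by
      have := hS.semigroup.hasDerivWithinAt hg le_rfl
      rw [hS.semigroup.zero] at this
      have h2 := HasDerivWithinAt.scomp_of_eq (x := s) (h := fun r : ℝ => r - s) (h' := 1)
        (s := Ici s) this ((hasDerivWithinAt_id s _).sub_const s)
        (fun r hr => by simpa using hr) (by simp)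
      simpa [Function.comp_def] using h2
    have e3 := e1.sub e2
    rw [sub_self] at e3
    rw [← hasDerivWithinAt_Ioi_iff_Ici,
      hasDerivWithinAt_iff_tendsto_slope' self_notMem_Ioi] at e3 ⊢
    have e4 := e3.norm.const_mul M
    rw [norm_zero, mul_zero] at e4
    refine squeeze_zero_norm' ?_ e4
    filter_upwards [Ioo_mem_nhdsGT hs.2] with r hr
    have a1 : 0 ≤ t - r := by linarith [hr.2]
    have a2 : 0 ≤ r - s := by linarith [hr.1]
    have := congrArg (fun L => L (T s v)) (hS.semigroup.add (t - r) (r - s) a1 a2)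
    simp only [ContinuousLinearMap.comp_apply, sub_add_sub_cancel] at this
    -- Factor out `S (t - r)`, which is bounded by `M`. What remains is the slope of the difference
    -- of two orbits that leave `T s v` with the same velocity `T s u`.
    have e5 : slope (fun s => S (t - s) (T s v)) s r =
        S (t - r) (slope ((fun s => T s v) - fun r => S (r - s) (T s v)) s r) := by
      simp [slope_def_module, this, hS.semigroup.zero]
    rw [e5]
    exact (S (t - r)).le_of_opNorm_le (hM _ a1) _
  have := constant_of_has_deriv_right_zero hc hd t ⟨ht, le_rfl⟩
  simpa [hS.semigroup.zero, hT.semigroup.zero] using this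

/-- A semigroup is determined by its generator `G`, if `1 - G` is surjective and some semigroup
generated by `G` is bounded. -/
theorem IsGeneratedBy.eq_of_bounded (hS : IsGeneratedBy S G) (hT : IsGeneratedBy T G)
    (hM : ∀ t, 0 ≤ t → ‖S t‖ ≤ M) (hG : ∀ v, ∃ w, G w (w - v)) {t : ℝ} (ht : 0 ≤ t) :
    T t = S t := by
  ext v
  -- Surjectivity of `1 - G` replaces density of the domain: `v` is `w` minus its image under `G`.
  -- Both semigroups agree on `w`, hence also on that image, because the generator commutes with
  -- each of them.
  obtain ⟨w, hw⟩ := hG v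
  have h1 := eq_on_domain hS hT hM hw ht
  have h2 := hT.semigroup.tendsto_generator_apply ((hT.generator _ _).1 hw) ht
  have h3 := hS.semigroup.tendsto_generator_apply ((hS.generator _ _).1 hw) ht
  rw [h1] at h2
  have h4 := tendsto_nhds_unique ((hS.generator _ _).1 ((hT.generator _ _).2 h2)) h3
  rw [map_sub, map_sub, h1] at h4
  exact sub_right_injective h4

/-- The orbit of an eigenvector for the eigenvalue `1` is `exp t • v`, which is unbounded unless `v
= 0`. -/
theorem IsC0Semigroup.eq_zero_of_generator_eq_self (hS : IsC0Semigroup S)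
    (hM : ∀ t, 0 ≤ t → ‖S t‖ ≤ M)
    (h : Tendsto (fun h : ℝ => h⁻¹ • (S h v - v)) (𝓝[>] 0) (𝓝 v)) : v = 0 := by
  have h1 : ∀ t : ℝ, 0 ≤ t → Real.exp (-t) • S t v = v := by
    intro t ht
    have hc : ContinuousOn (fun t : ℝ => Real.exp (-t) • S t v) (Icc 0 t) :=
      ContinuousOn.smul (by fun_prop) ((hS.cont v).mono Icc_subset_Ici_self)
    have hd : ∀ s ∈ Ico 0 t,
        HasDerivWithinAt (fun t : ℝ => Real.exp (-t) • S t v) 0 (Ici s) s := by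
      intro s hs
      have a := hS.hasDerivWithinAt h hs.1
      have b : HasDerivWithinAt (fun t : ℝ => Real.exp (-t)) (-Real.exp (-s)) (Ici s) s := by
        simpa using (hasDerivAt_neg s).exp.hasDerivWithinAt
      have c := b.smul a
      simp only [neg_smul, add_neg_cancel] at c
      exact c
    simpa [hS.zero] using constant_of_has_deriv_right_zero hc hd t ⟨ht, le_rfl⟩
  have h2 : Tendsto (fun t : ℝ => Real.exp (-t) * (M * ‖v‖)) atTop (𝓝 0) := by
    simpa using (Real.tendsto_exp_neg_atTop_nhds_zero).mul_const (M * ‖v‖)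
  have h3 : ‖v‖ ≤ 0 := by
    refine ge_of_tendsto h2 ?_
    filter_upwards [eventually_ge_atTop 0] with t ht
    calc ‖v‖ = ‖Real.exp (-t) • S t v‖ := by rw [h1 t ht]
      _ = Real.exp (-t) * ‖S t v‖ := by
        rw [norm_smul, Real.norm_eq_abs, abs_of_pos (Real.exp_pos _)]
      _ ≤ _ := by
        gcongr
        exact (S t).le_of_opNorm_le (hM t ht) _
  simpa using h3

/-- A bounded semigroup is generated by `G` if its generator and `G` have a common restriction
`G'` with `1 - G'` surjective, and `1 - G` is injective. -/
theorem IsC0Semigroup.isGeneratedBy (hS : IsC0Semigroup S) (hM : ∀ t, 0 ≤ t → ‖S t‖ ≤ M)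
    (hsurj : ∀ v, ∃ w, G w (w - v) ∧
      Tendsto (fun h : ℝ => h⁻¹ • (S h w - w)) (𝓝[>] 0) (𝓝 (w - v)))
    (hsub : ∀ v u v' u', G v u → G v' u' → G (v - v') (u - u'))
    (hinj : ∀ z, G z z → z = 0) : IsGeneratedBy S G := by
  refine ⟨hS, fun v u => ?_⟩
  -- Whichever of the two operators sends `v` to `u`, it sends `v - w` to itself, and neither of
  -- them has such a nonzero fixed vector. Hence `v = w`, which lies in both domains.
  obtain ⟨w, hw1, hw2⟩ := hsurj (v - u)
  constructor
  · intro h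
    have := hsub _ _ _ _ h hw1
    have e : u - (w - (v - u)) = v - w := by abel
    rw [e] at this
    have h3 : v = w := sub_eq_zero.1 (hinj _ this)
    simpa [← h3] using hw2
  · intro h
    have h1 : Tendsto (fun h : ℝ => h⁻¹ • (S h (v - w) - (v - w))) (𝓝[>] 0) (𝓝 (v - w)) := by
      have e : u - (w - (v - u)) = v - w := by abel
      have h2 := h.sub hw2
      rw [e] at h2
      refine h2.congr fun r => ?_
      rw [← smul_sub, map_sub (S r) v w]
      congr 1
      abel
    have h3 : v = w := sub_eq_zero.1 (hS.eq_zero_of_generator_eq_self hM h1)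
    simpa [← h3] using hw1

end Generators

/-! ### Gaussian averages of bounded groups -/

section Groups

variable {X : Type*} [NormedAddCommGroup X] [NormedSpace ℝ X]
  {U : ℝ → X →L[ℝ] X} {M : ℝ}

/-- A bounded strongly continuous group of operators. -/
structure IsBoundedGroup (U : ℝ → X →L[ℝ] X) (M : ℝ) : Prop where
  zero : U 0 = ContinuousLinearMap.id ℝ X
  add : ∀ s t : ℝ, U (s + t) = (U s).comp (U t)
  bound : ∀ s, ‖U s‖ ≤ M
  cont : ∀ v : X, Continuous fun s : ℝ => U s v

namespace IsBoundedGroup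

theorem add_apply (hU : IsBoundedGroup U M) (s t : ℝ) (v : X) : U (s + t) v = U s (U t v) := by
  rw [hU.add, ContinuousLinearMap.comp_apply]

theorem zero_apply (hU : IsBoundedGroup U M) (v : X) : U 0 v = v := by
  rw [hU.zero, ContinuousLinearMap.id_apply]

theorem norm_apply_le (hU : IsBoundedGroup U M) (s : ℝ) (v : X) : ‖U s v‖ ≤ M * ‖v‖ :=
  (U s).le_of_opNorm_le (hU.bound s) v

theorem nonneg (hU : IsBoundedGroup U M) : 0 ≤ M := (norm_nonneg _).trans (hU.bound 0)

theorem neg (hU : IsBoundedGroup U M) : IsBoundedGroup (fun s => U (-s)) M where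
  zero := by simp [hU.zero]
  add s t := by rw [neg_add, hU.add]
  bound s := hU.bound _
  cont v := (hU.cont v).comp continuous_neg

/-- The group `A U B` with `A`, `B` inverse to one another. -/
theorem conj (hU : IsBoundedGroup U M) {A B : X →L[ℝ] X}
    (hAB : A.comp B = ContinuousLinearMap.id ℝ X) (hBA : B.comp A = ContinuousLinearMap.id ℝ X) :
    IsBoundedGroup (fun s => A.comp ((U s).comp B)) (‖A‖ * (M * ‖B‖)) where
  zero := by simp [hU.zero, hAB]
  add s t := by
    ext v
    have : ∀ x, B (A x) = x := fun x => congrArg (fun L => L x) hBA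
    simp [hU.add, this]
  bound s := (A.opNorm_comp_le _).trans (by
    gcongr
    refine ((U s).opNorm_comp_le _).trans ?_
    gcongr
    exact hU.bound s)
  cont v := A.continuous.comp (hU.cont _)

theorem integrable (hU : IsBoundedGroup U M) (μ : Measure ℝ) [IsFiniteMeasure μ] (v : X) :
    Integrable (fun y => U y v) μ :=
  Integrable.of_bound (hU.cont v).aestronglyMeasurable (M * ‖v‖)
    (ae_of_all _ fun s => hU.norm_apply_le s v)

theorem integrable_smul (hU : IsBoundedGroup U M) {μ : Measure ℝ} {k : ℝ → ℝ}
    (hk : Integrable k μ) (v : X) : Integrable (fun y => k y • U y v) μ := by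
  refine (hk.norm.mul_const (M * ‖v‖)).mono'
    (hk.aestronglyMeasurable.smul (hU.cont v).aestronglyMeasurable) (ae_of_all _ fun s => ?_)
  rw [norm_smul]
  exact mul_le_mul_of_nonneg_left (hU.norm_apply_le s v) (norm_nonneg _)

theorem hasDerivAt (hU : IsBoundedGroup U M) {v u : X} (h : HasDerivAt (fun s => U s v) u 0)
    (s : ℝ) : HasDerivAt (fun s => U s v) (U s u) s := by
  have h1 : HasDerivAt (fun r => U (r - s) v) u s := by
    have := HasDerivAt.scomp_of_eq (x := s) (h := fun r : ℝ => r - s) (h' := 1) h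
      ((hasDerivAt_id s).sub_const s) (by simp)
    simpa [Function.comp_def] using this
  have h2 := (U s).hasFDerivAt.comp_hasDerivAt s h1
  refine h2.congr_of_eventuallyEq (Eventually.of_forall fun r => ?_)
  simp [← hU.add_apply]

/-- The mean of the group with respect to a finite measure. -/
noncomputable def average (hU : IsBoundedGroup U M) (μ : Measure ℝ) [IsFiniteMeasure μ] :
    X →L[ℝ] X :=
  LinearMap.mkContinuous
    { toFun := fun v => ∫ y, U y v ∂μ
      map_add' := fun v w => by
        simp only [map_add]
        exact integral_add (hU.integrable μ v) (hU.integrable μ w)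
      map_smul' := fun c v => by
        simp only [map_smul, RingHom.id_apply]
        exact integral_smul c _ }
    (M * μ.real univ) fun v => by
      refine (norm_integral_le_of_norm_le_const (ae_of_all _ fun s => hU.norm_apply_le s v)).trans
        (le_of_eq ?_)
      ring

theorem average_apply (hU : IsBoundedGroup U M) (μ : Measure ℝ) [IsFiniteMeasure μ] (v : X) :
    hU.average μ v = ∫ y, U y v ∂μ := rfl

theorem norm_average_le (hU : IsBoundedGroup U M) (μ : Measure ℝ) [IsProbabilityMeasure μ] :
    ‖hU.average μ‖ ≤ M := by
  refine (LinearMap.mkContinuous_norm_le _ (mul_nonneg hU.nonneg measureReal_nonneg) _).trans ?_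
  simp

/-- The group law turns convolution into composition. Applied to Gaussians, whose variances add, it
gives the semigroup law. -/
theorem average_conv [CompleteSpace X] (hU : IsBoundedGroup U M) (μ ν : Measure ℝ)
    [IsFiniteMeasure μ] [IsFiniteMeasure ν] : hU.average (μ.conv ν) = (hU.average μ).comp (hU.average ν) := by
  ext v
  rw [ContinuousLinearMap.comp_apply, average_apply, average_apply, average_apply,
    integral_conv (hU.integrable _ v)]
  refine integral_congr_ae (ae_of_all _ fun x => ?_)
  simp only [hU.add_apply]
  exact (U x).integral_comp_comm (hU.integrable ν v)

/-- The Gaussian semigroup built from the group `U`. -/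
noncomputable def gaussian (hU : IsBoundedGroup U M) (t : ℝ) : X →L[ℝ] X :=
  hU.average (ProbabilityTheory.gaussianReal 0 t.toNNReal)

theorem gaussian_apply (hU : IsBoundedGroup U M) (t : ℝ) (v : X) :
    hU.gaussian t v = ∫ y, U y v ∂(ProbabilityTheory.gaussianReal 0 t.toNNReal) := rfl

theorem norm_gaussian_le (hU : IsBoundedGroup U M) (t : ℝ) : ‖hU.gaussian t‖ ≤ M :=
  hU.norm_average_le _

/-- Rescaling to a fixed measure puts the dependence on `t` into the integrand, where dominated
convergence applies, also at `t = 0`. -/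
theorem gaussian_apply_eq_standard (hU : IsBoundedGroup U M) {t : ℝ} (ht : 0 ≤ t) (v : X) :
    hU.gaussian t v = ∫ z, U (√t * z) v ∂(ProbabilityTheory.gaussianReal 0 1) := by
  have h := ProbabilityTheory.gaussianReal_map_const_mul (μ := 0) (v := 1) (√t)
  have e : (NNReal.mk (√t ^ 2) (sq_nonneg _)) * 1 = t.toNNReal := by
    rw [mul_one]
    ext
    simp [Real.sq_sqrt ht, ht]
  rw [mul_zero, e] at h
  rw [gaussian_apply, ← h, integral_map (by fun_prop)]
  exact (hU.cont v).aestronglyMeasurable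

theorem isC0Semigroup_gaussian [CompleteSpace X] (hU : IsBoundedGroup U M) :
    IsC0Semigroup hU.gaussian where
  zero := by
    ext v
    simp [gaussian_apply, hU.zero]
  add s t hs ht := by
    ext v
    have h := ProbabilityTheory.gaussianReal_conv_gaussianReal (m₁ := 0) (m₂ := 0)
      (v₁ := s.toNNReal) (v₂ := t.toNNReal)
    rw [add_zero, ← Real.toNNReal_add hs ht] at h
    rw [gaussian_apply, ← h]
    exact congrArg (fun L => L v) (hU.average_conv
      (ProbabilityTheory.gaussianReal 0 s.toNNReal) (ProbabilityTheory.gaussianReal 0 t.toNNReal))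
  cont v := by
    have : Continuous fun t : ℝ => ∫ z, U (√t * z) v ∂(ProbabilityTheory.gaussianReal 0 1) := by
      refine continuous_of_dominated (bound := fun _ => M * ‖v‖) (fun t => ?_)
        (fun t => ae_of_all _ fun z => hU.norm_apply_le _ _) (integrable_const _)
        (ae_of_all _ fun z => (hU.cont v).comp (by fun_prop))
      exact ((hU.cont v).comp (by fun_prop : Continuous fun z => √t * z)).aestronglyMeasurable
    exact this.continuousOn.congr fun t ht => hU.gaussian_apply_eq_standard ht v

end IsBoundedGroup

/-- A function vanishing at `0` whose derivative at `x` is at most `C |x|` grows at most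
quadratically. -/
theorem norm_le_mul_sq_of_hasDerivAt {f f' : ℝ → X} {C δ : ℝ} (hf : ∀ x, HasDerivAt f (f' x) x)
    (h0 : f 0 = 0) (hC : 0 ≤ C) (hb : ∀ x, |x| ≤ δ → ‖f' x‖ ≤ C * |x|) {s : ℝ} (hs : |s| ≤ δ) :
    ‖f s‖ ≤ C * s ^ 2 := by
  have := (convex_Icc (-|s|) |s|).norm_image_sub_le_of_norm_hasDerivWithin_le (f := f) (f' := f')
    (C := C * |s|) (x := 0) (y := s) (fun x _ => (hf x).hasDerivWithinAt) (fun x hx => ?_)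
    (by simp) ⟨neg_abs_le s, le_abs_self s⟩
  · simpa [h0, mul_assoc, ← sq] using this
  · have hx' : |x| ≤ |s| := abs_le.2 hx
    exact (hb x (hx'.trans hs)).trans (by gcongr)

namespace IsBoundedGroup

variable [CompleteSpace X]

/-- On twice differentiable vectors the Gaussian semigroup has half the second derivative as its
generator. -/
theorem tendsto_gaussian (hU : IsBoundedGroup U M) {w w₁ u : X}
    (h₁ : ∀ s, HasDerivAt (fun s => U s w) (U s w₁) s)
    (h₂ : ∀ s, HasDerivAt (fun s => U s w₁) (U s u) s) :
    Tendsto (fun h : ℝ => h⁻¹ • (hU.gaussian h w - w)) (𝓝[>] 0) (𝓝 ((1 / 2 : ℝ) • u)) := by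
  set γ := ProbabilityTheory.gaussianReal 0 1
  -- First-order Taylor remainder of the orbit. It is `s² / 2 • u + o(s²)` near `0` and at most `M
  -- ‖u‖ s²` everywhere; the latter provides the dominating function.
  set Ψ : ℝ → X := fun s => U s w - w - s • w₁ with hΨ
  have dΨ : ∀ s, HasDerivAt Ψ (U s w₁ - w₁) s := fun s => by
    have := ((h₁ s).sub_const w).sub ((hasDerivAt_id s).smul_const w₁)
    rw [one_smul] at this
    exact this
  have Ψ0 : Ψ 0 = 0 := by simp [hΨ, hU.zero]
  have bΨ : ∀ s, ‖Ψ s‖ ≤ M * ‖u‖ * s ^ 2 := fun s => by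
    refine norm_le_mul_sq_of_hasDerivAt dΨ Ψ0 (mul_nonneg hU.nonneg (norm_nonneg _))
      (fun x _ => ?_) le_rfl
    have := convex_univ.norm_image_sub_le_of_norm_hasDerivWithin_le (f := fun s => U s w₁)
      (x := 0) (y := x) (fun x _ => (h₂ x).hasDerivWithinAt) (fun x _ => hU.norm_apply_le x u)
      trivial trivial
    simpa [hU.zero] using this
  have lΨ : (fun s => Ψ s - (s ^ 2 / 2) • u) =o[𝓝 0] fun s => s ^ 2 := by
    rw [Asymptotics.isLittleO_iff]
    intro c hc
    have h3 := (hasDerivAt_iff_isLittleO_nhds_zero.1 (h₂ 0))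
    have h4 := Metric.eventually_nhds_iff.1 ((Asymptotics.isLittleO_iff.1 h3) hc)
    obtain ⟨ε, hε, h4⟩ := h4
    refine Metric.eventually_nhds_iff.2 ⟨ε / 2, by positivity, fun s hs => ?_⟩
    rw [Real.norm_of_nonneg (sq_nonneg s)]
    refine norm_le_mul_sq_of_hasDerivAt (f := fun s => Ψ s - (s ^ 2 / 2) • u)
      (f' := fun s => U s w₁ - w₁ - s • u) (δ := ε / 2)
      (fun x => ?_) (by rw [Ψ0]; simp) hc.le (fun x hx => ?_) ?_
    · exact ((dΨ x).sub (((hasDerivAt_pow 2 x).div_const 2).smul_const u)).congr_deriv (by simp)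
    · have := @h4 x (by rw [Real.dist_0_eq_abs]; linarith)
      simpa [hU.zero] using this
    · simpa using hs.le
  have iz : Integrable (fun z : ℝ => z) γ :=
    (ProbabilityTheory.memLp_id_gaussianReal 1).integrable (by simp)
  have iz2 : Integrable (fun z : ℝ => z ^ 2) γ :=
    (ProbabilityTheory.memLp_id_gaussianReal 2).integrable_sq
  have mz2 : ∫ z, z ^ 2 ∂γ = 1 := by
    have := ProbabilityTheory.variance_fun_id_gaussianReal (μ := 0) (v := 1)
    rw [ProbabilityTheory.variance_eq_integral (by fun_prop)] at this
    simpa using this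
  -- The linear Taylor term may be subtracted at no cost, since the Gaussian has mean zero.
  have key : ∀ h : ℝ, 0 < h → h⁻¹ • (hU.gaussian h w - w) = ∫ z, h⁻¹ • Ψ (√h * z) ∂γ := by
    intro h hh
    have i1 : Integrable (fun z => U (√h * z) w) γ :=
      Integrable.of_bound ((hU.cont w).comp (by fun_prop :
        Continuous fun z => √h * z)).aestronglyMeasurable (M * ‖w‖)
        (ae_of_all _ fun s => hU.norm_apply_le _ w)
    rw [integral_smul, hU.gaussian_apply_eq_standard hh.le]
    congr 1
    simp only [hΨ]
    have i2 : Integrable (fun z => U (√h * z) w - w) γ := i1.sub (integrable_const w)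
    have i3 : Integrable (fun z => (√h * z) • w₁) γ := (iz.const_mul _).smul_const _
    rw [integral_sub i2 i3, integral_sub i1 (integrable_const w), integral_smul_const,
      integral_const_mul, ProbabilityTheory.integral_id_gaussianReal]
    simp [γ]
  have e : (1 / 2 : ℝ) • u = ∫ z, (z ^ 2 / 2) • u ∂γ := by
    rw [integral_smul_const, integral_div, mz2]
  rw [e]
  have : Tendsto (fun h : ℝ => ∫ z, h⁻¹ • Ψ (√h * z) ∂γ) (𝓝[>] 0)
      (𝓝 (∫ z, (z ^ 2 / 2) • u ∂γ)) := by
    refine tendsto_integral_filter_of_dominated_convergence (fun z => M * ‖u‖ * z ^ 2)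
      (Eventually.of_forall fun h => ?_) ?_ (iz2.const_mul _) (ae_of_all _ fun z => ?_)
    · have : Continuous Ψ := continuous_iff_continuousAt.2 fun s => (dΨ s).continuousAt
      exact (this.comp (by fun_prop : Continuous fun z => √h * z)).aestronglyMeasurable.const_smul _
    · filter_upwards [self_mem_nhdsWithin] with h hh
      have hh : 0 < h := hh
      refine ae_of_all _ fun z => ?_
      rw [norm_smul, norm_inv, Real.norm_of_nonneg hh.le, inv_mul_le_iff₀ hh]
      refine (bΨ _).trans (le_of_eq ?_)
      rw [mul_pow, Real.sq_sqrt hh.le]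
      ring
    · have h1 : Tendsto (fun h : ℝ => √h * z) (𝓝[>] 0) (𝓝 0) := by
        have : Continuous fun h : ℝ => √h * z := by fun_prop
        simpa using (this.tendsto 0).mono_left nhdsWithin_le_nhds
      have h2 := lΨ.comp_tendsto h1
      rw [Asymptotics.isLittleO_iff] at h2
      rw [Metric.tendsto_nhds]
      intro ε hε
      have hc : 0 < ε / (z ^ 2 + 1) := by positivity
      filter_upwards [h2 hc, self_mem_nhdsWithin] with h hh1 hh
      have hh : 0 < h := hh
      simp only [Function.comp_apply, mul_pow, Real.sq_sqrt hh.le] at hh1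
      have e2 : h⁻¹ • Ψ (√h * z) - (z ^ 2 / 2) • u =
          h⁻¹ • (Ψ (√h * z) - (h * z ^ 2 / 2) • u) := by
        have : h⁻¹ * (h * z ^ 2 / 2) = z ^ 2 / 2 := by field_simp
        rw [smul_sub h⁻¹ (Ψ (√h * z)) ((h * z ^ 2 / 2) • u), smul_smul, this]
      rw [dist_eq_norm, e2, norm_smul, norm_inv, Real.norm_of_nonneg hh.le, inv_mul_lt_iff₀ hh]
      refine hh1.trans_lt ?_
      rw [Real.norm_of_nonneg (by positivity)]
      rw [div_mul_eq_mul_div, div_lt_iff₀ (by positivity)]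
      nlinarith [mul_pos hh hε, sq_nonneg z]
  refine this.congr' ?_
  filter_upwards [self_mem_nhdsWithin] with h hh
  exact (key h hh).symm

/-- The Laplace transform of an orbit is a differentiable vector. -/
theorem hasDerivAt_laplace (hU : IsBoundedGroup U M) {l : ℝ} (hl : 0 < l) (v : X) (s : ℝ) :
    HasDerivAt (fun s => U s (∫ r in Ioi (0 : ℝ), Real.exp (-l * r) • U r v))
      (U s (l • (∫ r in Ioi (0 : ℝ), Real.exp (-l * r) • U r v) - v)) s := by
  set R := ∫ r in Ioi (0 : ℝ), Real.exp (-l * r) • U r v with hR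
  refine hU.hasDerivAt ?_ s
  have hi : ∀ a, IntegrableOn (fun r => Real.exp (-l * r) • U r v) (Ioi a) := fun a =>
    hU.integrable_smul (integrableOn_exp_mul_Ioi (by linarith) a) v
  have hc : Continuous fun r : ℝ => Real.exp (-l * r) • U r v :=
    Continuous.smul (by fun_prop) (hU.cont v)
  -- Shifting the variable of integration moves `s` into the limit of the integral and an
  -- exponential factor, both of which can be differentiated.
  have h1 : ∀ s, U s R = Real.exp (l * s) • (R - ∫ r in (0 : ℝ)..s, Real.exp (-l * r) • U r v) := by
    intro s
    have e1 : R - ∫ r in (0 : ℝ)..s, Real.exp (-l * r) • U r v =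
        ∫ r in Ioi s, Real.exp (-l * r) • U r v := by
      rw [hR, ← intervalIntegral.integral_interval_add_Ioi' (hc.intervalIntegrable 0 s) (hi s)]
      abel
    have e2 := (U s).integral_comp_comm (hi 0)
    have e3 : ∫ r in Ioi s, Real.exp (-l * r) • U r v =
        ∫ r in Ioi (0 : ℝ), Real.exp (-l * (r + s)) • U (r + s) v := by
      have := (measurePreserving_add_right volume s).setIntegral_preimage_emb
        (measurableEmbedding_addRight s) (fun r => Real.exp (-l * r) • U r v) (Ioi s)
      rw [← this]
      simp
    rw [e1, e3, ← e2, ← integral_smul]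
    refine integral_congr_ae (ae_of_all _ fun r => ?_)
    simp only [map_smul]
    rw [smul_smul, ← Real.exp_add, add_comm r s, hU.add_apply]
    congr 2
    ring
  have h2 : HasDerivAt (fun s : ℝ => R - ∫ r in (0 : ℝ)..s, Real.exp (-l * r) • U r v) (-v) 0 := by
    have := (hc.integral_hasStrictDerivAt 0 0).hasDerivAt.const_sub R
    simpa [hU.zero] using this
  have h3 : HasDerivAt (fun s : ℝ => Real.exp (l * s)) l 0 := by
    simpa using ((hasDerivAt_id (0 : ℝ)).const_mul l).exp
  have h4 := h3.smul h2
  have e : l • R - v =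
      Real.exp (l * 0) • -v + l • (R - ∫ r in (0:ℝ)..0, Real.exp (-l * r) • U r v) := by
    simp
    abel
  rw [e]
  exact h4.congr_of_eventuallyEq (Eventually.of_forall h1)

/-- The range of `1 - ½ d²/ds²` on twice differentiable vectors is the whole space. -/
theorem exists_resolvent (hU : IsBoundedGroup U M) (v : X) : ∃ w w₁ : X,
    (∀ s, HasDerivAt (fun s => U s w) (U s w₁) s) ∧
    ∀ s, HasDerivAt (fun s => U s w₁) (U s ((2 : ℝ) • (w - v))) s := by
  have hl : (0 : ℝ) < √2 := by positivity
  have hl2 : √2 * √2 = (2 : ℝ) := by simp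
  set R := ∫ r in Ioi (0 : ℝ), Real.exp (-√2 * r) • U r v with hR
  set L := ∫ r in Ioi (0 : ℝ), Real.exp (-√2 * r) • U (-r) v with hL
  have dR : ∀ s, HasDerivAt (fun s => U s R) (U s (√2 • R - v)) s := hU.hasDerivAt_laplace hl v
  have dL : ∀ s, HasDerivAt (fun s => U s L) (U s (v - √2 • L)) s := by
    intro s
    have h1 := HasDerivAt.scomp (x := s) (h := fun r : ℝ => -r) (h' := -1)
      (hU.neg.hasDerivAt_laplace hl v (-s)) (hasDerivAt_neg s)
    simp only [neg_neg, neg_smul, one_smul, ← map_neg, neg_sub, Function.comp_def] at h1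
    exact h1
  -- With `B` the generator of the group, `B R = √2 R - v` and `B L = v - √2 L`. This is the partial
  -- fraction decomposition of `(2 - B²)⁻¹` into the resolvents of `B` and `-B` at `√2`.
  refine ⟨(√2 / 2) • (R + L), R - L, fun s => ?_, fun s => ?_⟩
  · have h := ((dR s).add (dL s)).const_smul (√2 / 2)
    have e : U s (R - L) = (√2 / 2) • (U s (√2 • R - v) + U s (v - √2 • L)) := by
      rw [← map_add, ← map_smul]
      congr 1
      rw [sub_add_sub_cancel, ← smul_sub, smul_smul, div_mul_eq_mul_div, hl2]
      simp
    rw [e]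
    refine h.congr_of_eventuallyEq (Eventually.of_forall fun r => ?_)
    simp
  · have h := (dR s).sub (dL s)
    have e : U s ((2 : ℝ) • ((√2 / 2) • (R + L) - v)) = U s (√2 • R - v) - U s (v - √2 • L) := by
      rw [← map_sub]
      congr 1
      module
    rw [e]
    refine h.congr_of_eventuallyEq (Eventually.of_forall fun r => ?_)
    simp

/-- Identification of the generator of the Gaussian semigroup. -/
theorem isGeneratedBy_gaussian (hU : IsBoundedGroup U M) {D : X → X → Prop}
    (hD : ∀ w w₁ u, (∀ s, HasDerivAt (fun s => U s w) (U s w₁) s) →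
      (∀ s, HasDerivAt (fun s => U s w₁) (U s u) s) → D w u)
    (hsub : ∀ v u v' u', D v u → D v' u' → D (v - v') (u - u'))
    (hinj : ∀ z, D z ((2 : ℝ) • z) → z = 0) :
    IsGeneratedBy hU.gaussian (Half D) ∧ ∀ v, ∃ w, Half D w (w - v) := by
  have h : ∀ v, ∃ w, Half D w (w - v) ∧
      Tendsto (fun h : ℝ => h⁻¹ • (hU.gaussian h w - w)) (𝓝[>] 0) (𝓝 (w - v)) := by
    intro v
    obtain ⟨w, w₁, h₁, h₂⟩ := hU.exists_resolvent v
    refine ⟨w, ⟨_, hD _ _ _ h₁ h₂, by simp [smul_smul]⟩, ?_⟩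
    simpa [smul_smul] using hU.tendsto_gaussian h₁ h₂
  refine ⟨hU.isC0Semigroup_gaussian.isGeneratedBy (fun t _ => hU.norm_gaussian_le t) h ?_ ?_,
    fun v => (h v).imp fun _ => And.left⟩
  · rintro v _ v' _ ⟨a, ha, rfl⟩ ⟨b, hb, rfl⟩
    exact ⟨_, hsub _ _ _ _ ha hb, by rw [smul_sub]⟩
  · rintro z ⟨a, ha, hz⟩
    refine hinj z ?_
    have : (2 : ℝ) • z = a := by rw [hz, smul_smul]; simp
    rwa [this]

end IsBoundedGroup

end Groups

/-! ### Second derivatives on half-lines and the equation `Z'' = 2Z` -/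

section Calculus

theorem contDiffOn_two_of_eqOn {s : Set ℝ} (hs : UniqueDiffOn ℝ s) {f F F₁ F₂ : ℝ → ℝ}
    (hf : EqOn f F s) (h₁ : ∀ x, HasDerivAt F (F₁ x) x) (h₂ : ∀ x, HasDerivAt F₁ (F₂ x) x)
    (hc : Continuous F₂) : ContDiffOn ℝ 2 f s ∧ (∀ x ∈ s, derivWithin f s x = F₁ x) ∧
      ∀ x ∈ s, iteratedDerivWithin 2 f s x = F₂ x := by
  have e₁ : deriv F = F₁ := funext fun x => (h₁ x).deriv
  have e₂ : deriv F₁ = F₂ := funext fun x => (h₂ x).deriv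
  have d₁ : ContDiff ℝ 1 F₁ := by
    rw [contDiff_one_iff_deriv, e₂]
    exact ⟨fun x => (h₂ x).differentiableAt, hc⟩
  have d₂ : ContDiff ℝ 2 F := by
    have : ContDiff ℝ (1 + 1) F := by
      rw [contDiff_succ_iff_deriv, e₁]
      exact ⟨fun x => (h₁ x).differentiableAt, by simp, d₁⟩
    simpa [one_add_one_eq_two] using this
  have hd : ∀ x ∈ s, derivWithin f s x = F₁ x := fun x hx => by
    rw [derivWithin_congr hf (hf hx)]
    exact (h₁ x).hasDerivWithinAt.derivWithin (hs x hx)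
  refine ⟨d₂.contDiffOn.congr hf, hd, fun x hx => ?_⟩
  rw [iteratedDerivWithin_succ]
  have : EqOn (iteratedDerivWithin 1 f s) F₁ s := fun y hy => by
    rw [iteratedDerivWithin_one]
    exact hd y hy
  rw [derivWithin_congr this (this hx)]
  exact (h₂ x).hasDerivWithinAt.derivWithin (hs x hx)

theorem ContDiffOn.hasDerivWithinAt_derivWithin {s : Set ℝ} (hs : UniqueDiffOn ℝ s) {f : ℝ → ℝ}
    (hf : ContDiffOn ℝ 2 f s) {x : ℝ} (hx : x ∈ s) :
    HasDerivWithinAt f (derivWithin f s x) s x ∧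
      HasDerivWithinAt (derivWithin f s) (iteratedDerivWithin 2 f s x) s x := by
  refine ⟨(hf.differentiableOn (by simp) x hx).hasDerivWithinAt, ?_⟩
  have h1 : ContDiffOn ℝ 1 (derivWithin f s) s := hf.derivWithin hs (by norm_num)
  have := (h1.differentiableOn (by simp) x hx).hasDerivWithinAt
  rw [iteratedDerivWithin_succ]
  have e : iteratedDerivWithin 1 f s = derivWithin f s := by
    ext y
    rw [iteratedDerivWithin_one]
  rwa [e]

/-- A solution of `Z'' = 2 Z` on the half-line that does not blow up is a multiple of the decaying
exponential. -/
theorem eq_exp_of_deriv_deriv_eq {Z Z₁ : ℝ → ℝ}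
    (h₁ : ∀ x, 0 ≤ x → HasDerivWithinAt Z (Z₁ x) (Ici 0) x)
    (h₂ : ∀ x, 0 ≤ x → HasDerivWithinAt Z₁ (2 * Z x) (Ici 0) x)
    (hb : ¬ Tendsto (fun x => |Z x|) atTop atTop) :
    Z₁ 0 = -√2 * Z 0 ∧ ∀ x, 0 ≤ x → Z x = Z 0 * Real.exp (-√2 * x) := by
  have hl : (0 : ℝ) < √2 := by positivity
  have hl2 : √2 * √2 = (2 : ℝ) := by simp
  have const : ∀ F : ℝ → ℝ, (∀ x, 0 ≤ x → HasDerivWithinAt F 0 (Ici 0) x) →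
      ∀ x, 0 ≤ x → F x = F 0 := fun F hF x hx =>
    constant_of_has_deriv_right_zero
      (fun y hy => ((hF y hy.1).mono Icc_subset_Ici_self).continuousWithinAt)
      (fun y hy => (hF y hy.1).mono (Ici_subset_Ici.2 hy.1)) x ⟨hx, le_rfl⟩
  have dexp : ∀ l x : ℝ, HasDerivWithinAt (fun x => Real.exp (l * x)) (l * Real.exp (l * x))
      (Ici 0) x := fun l x => by
    simpa [mul_comm] using ((hasDerivAt_id x).const_mul l).exp.hasDerivWithinAt (s := Ici 0)
  set c := Z₁ 0 + √2 * Z 0 with hc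
  -- Factor the equation as `(d/dx - √2)(d/dx + √2) Z = 0` and integrate the two first-order
  -- equations in turn; `c` is the coefficient of the growing mode up to the factor `2√2`.
  have e1 : ∀ x, 0 ≤ x → Real.exp (-√2 * x) * (Z₁ x + √2 * Z x) = c := by
    intro x hx
    have := const (fun x => Real.exp (-√2 * x) * (Z₁ x + √2 * Z x)) (fun y hy => ?_) x hx
    · simpa [hc] using this
    · refine ((dexp (-√2) y).mul ((h₂ y hy).add ((h₁ y hy).const_mul √2))).congr_deriv ?_
      simp only [Pi.add_apply]
      linear_combination (-Real.exp (-√2 * y) * Z y) * hl2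
  have e2 : ∀ x, 0 ≤ x → Real.exp (√2 * x) * Z x - c / (2 * √2) * Real.exp (2 * √2 * x) =
      Z 0 - c / (2 * √2) := by
    intro x hx
    have := const (fun x => Real.exp (√2 * x) * Z x - c / (2 * √2) * Real.exp (2 * √2 * x))
      (fun y hy => ?_) x hx
    · simpa using this
    · refine (((dexp √2 y).mul (h₁ y hy)).sub ((dexp (2 * √2) y).const_mul _)).congr_deriv ?_
      have h3 : Real.exp (2 * √2 * y) * Real.exp (-√2 * y) = Real.exp (√2 * y) := by
        rw [← Real.exp_add]
        ring_nf
      rw [← e1 y hy]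
      field_simp
      rw [show -(√2 * y) = -√2 * y by ring, show √2 * y * 2 = 2 * √2 * y by ring]
      linear_combination (-(Z₁ y + √2 * Z y)) * h3
  have e3 : ∀ x, 0 ≤ x → Z x = c / (2 * √2) * Real.exp (√2 * x) +
      (Z 0 - c / (2 * √2)) * Real.exp (-√2 * x) := by
    intro x hx
    have h3 : Real.exp (√2 * x) * Real.exp (-√2 * x) = 1 := by
      rw [← Real.exp_add]
      simp
    have h4 : Real.exp (2 * √2 * x) * Real.exp (-√2 * x) = Real.exp (√2 * x) := by
      rw [← Real.exp_add]
      ring_nf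
    linear_combination Real.exp (-√2 * x) * e2 x hx - Z x * h3 + c / (2 * √2) * h4
  have hc0 : c = 0 := by
    by_contra h
    apply hb
    have t1 : Tendsto (fun x => |c / (2 * √2)| * Real.exp (√2 * x) - |Z 0 - c / (2 * √2)|)
        atTop atTop := by
      refine tendsto_atTop_add_const_right _ _ (Tendsto.const_mul_atTop ?_
        (Real.tendsto_exp_atTop.comp (tendsto_id.const_mul_atTop hl)))
      exact abs_pos.2 (by positivity)
    refine tendsto_atTop_mono' _ ?_ t1
    filter_upwards [eventually_ge_atTop 0] with x hx
    have h5 : Real.exp (-√2 * x) ≤ 1 := Real.exp_le_one_iff.2 (by nlinarith)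
    have h6 : |(Z 0 - c / (2 * √2)) * Real.exp (-√2 * x)| ≤ |Z 0 - c / (2 * √2)| := by
      rw [abs_mul, Real.abs_exp]
      exact mul_le_of_le_one_right (abs_nonneg _) h5
    have h7 : |c / (2 * √2) * Real.exp (√2 * x)| = |c / (2 * √2)| * Real.exp (√2 * x) := by
      rw [abs_mul, Real.abs_exp]
    have h8 := abs_sub_abs_le_abs_add (c / (2 * √2) * Real.exp (√2 * x))
      ((Z 0 - c / (2 * √2)) * Real.exp (-√2 * x))
    rw [e3 x hx]
    linarith
  refine ⟨by linarith, fun x hx => ?_⟩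
  have := e3 x hx
  simpa [hc0] using this

end Calculus

/-! ### The group and the generator in `C[-∞,+∞]` -/

section ContinuousFunctions

/-! The structures on `C[-∞,+∞]` that come from its norm; they agree by definition with those of a
submodule, and the elaborator has to be told which to prefer. -/

noncomputable local instance normAddCommGroupCBar : AddCommGroup CBar :=
  (inferInstance : NormedAddCommGroup CBar).toAddCommGroup

noncomputable local instance normAddCommMonoidCBar : AddCommMonoid CBar :=
  (inferInstance : NormedAddCommGroup CBar).toAddCommGroup.toAddCommMonoid

noncomputable local instance normTopologyCBar : TopologicalSpace CBar :=
  (inferInstance : NormedAddCommGroup CBar).toSeminormedAddCommGroup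
    |>.toPseudoMetricSpace.toUniformSpace.toTopologicalSpace

noncomputable local instance normModuleCBar : Module ℝ CBar :=
  (inferInstance : NormedSpace ℝ CBar).toModule

theorem isClosed_cBar : IsClosed (CBar : Set (ℝ →ᵇ ℝ)) := by
  have key : ∀ (F : Filter ℝ) [F.NeBot] (f : ℝ →ᵇ ℝ),
      (∀ ε > 0, ∃ g : ℝ →ᵇ ℝ, dist f g < ε ∧ ∃ l, Tendsto g F (𝓝 l)) →
        ∃ l, Tendsto f F (𝓝 l) := by
    intro F _ f hf
    rw [← cauchy_map_iff_exists_tendsto, Metric.cauchy_iff]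
    refine ⟨inferInstance, fun ε hε => ?_⟩
    obtain ⟨g, hg, l, hl⟩ := hf (ε / 4) (by positivity)
    refine ⟨_, image_mem_map ((Metric.tendsto_nhds.1 hl) (ε / 4) (by positivity)), ?_⟩
    rintro _ ⟨x, hx, rfl⟩ _ ⟨y, hy, rfl⟩
    have h1 := (BoundedContinuousFunction.dist_coe_le_dist (f := f) (g := g) x).trans_lt hg
    have h2 := (BoundedContinuousFunction.dist_coe_le_dist (f := f) (g := g) y).trans_lt hg
    simp only [mem_ofPred_eq, Real.dist_eq, abs_lt] at *
    constructor <;> linarith [h1.1, h1.2, h2.1, h2.2, hx.1, hx.2, hy.1, hy.2]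
  refine isClosed_of_closure_subset fun f hf => ?_
  rw [Metric.mem_closure_iff] at hf
  refine ⟨key atTop f fun ε hε => ?_, key atBot f fun ε hε => ?_⟩
  · obtain ⟨g, hg, h⟩ := hf ε hε
    exact ⟨g, h, hg.1⟩
  · obtain ⟨g, hg, h⟩ := hf ε hε
    exact ⟨g, h, hg.2⟩

instance : CompleteSpace CBar := isClosed_cBar.completeSpace_coe

/-- Subtract an affine function of the clamp of `x` to `[-1, 1]` with the same limits at `±∞`; the
rest is continuous and vanishes at infinity. This is what makes translations strongly continuous. -/
theorem uniformContinuous_cBar (f : CBar) : UniformContinuous f.1 := by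
  obtain ⟨⟨a, ha⟩, ⟨b, hb⟩⟩ := f.2
  set c : ℝ → ℝ := fun x => max (min x 1) (-1) with hc
  have uc : UniformContinuous c :=
    ((LipschitzWith.id.min_const 1).max_const (-1)).uniformContinuous
  have c1 : Tendsto c atTop (𝓝 1) := by
    refine tendsto_const_nhds.congr' ?_
    filter_upwards [eventually_ge_atTop 1] with x hx
    simp [hc, hx]
  have c2 : Tendsto c atBot (𝓝 (-1)) := by
    refine tendsto_const_nhds.congr' ?_
    filter_upwards [eventually_le_atBot (-1)] with x hx
    simp [hc, hx]
  have u2 : UniformContinuous fun x => (a + b) / 2 + (a - b) / 2 * c x :=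
    uniformContinuous_const.add (uc.const_mul' _)
  have h1 : UniformContinuous fun x => f.1 x - ((a + b) / 2 + (a - b) / 2 * c x) := by
    refine (f.1.continuous.sub u2.continuous).uniformContinuous_of_tendsto_cocompact (x := 0) ?_
    rw [cocompact_eq_atBot_atTop, tendsto_sup]
    constructor
    · have := hb.sub ((c2.const_mul ((a - b) / 2)).const_add ((a + b) / 2))
      convert this using 2
      ring
    · have := ha.sub ((c1.const_mul ((a - b) / 2)).const_add ((a + b) / 2))
      convert this using 2
      ring
  exact (h1.add u2).congr fun x => by simp

/-- Composition with a continuous map of the extended line that fixes the set of end points. -/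
noncomputable def compCBar (φ : C(ℝ, ℝ)) (h : ∀ f : CBar, f.1.compContinuous φ ∈ CBar) :
    CBar →L[ℝ] CBar :=
  LinearMap.mkContinuous
    { toFun := fun f => ⟨f.1.compContinuous φ, h f⟩
      map_add' := fun _ _ => rfl
      map_smul' := fun _ _ => rfl } 1 fun f => by
    rw [one_mul]
    exact (BoundedContinuousFunction.norm_le (f := f.1.compContinuous φ) (norm_nonneg f.1)).2
      fun x => f.1.norm_coe_le_norm (φ x)

theorem norm_compCBar_le (φ : C(ℝ, ℝ)) (h : ∀ f : CBar, f.1.compContinuous φ ∈ CBar) :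
    ‖compCBar φ h‖ ≤ 1 := LinearMap.mkContinuous_norm_le _ zero_le_one _

/-- Translation by `s`. -/
noncomputable def translCBar (s : ℝ) : CBar →L[ℝ] CBar :=
  compCBar ⟨fun x => x + s, by fun_prop⟩ fun f => by
    obtain ⟨⟨a, ha⟩, ⟨b, hb⟩⟩ := f.2
    exact ⟨⟨a, ha.comp (tendsto_atTop_add_const_right _ s tendsto_id)⟩,
      ⟨b, hb.comp (tendsto_atBot_add_const_right _ s tendsto_id)⟩⟩

theorem translCBar_apply (s : ℝ) (f : CBar) (x : ℝ) : (translCBar s f).1 x = f.1 (x + s) := rfl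

/-- The operator `f ↦ f(|x|) - f(-|x|)`. -/
noncomputable def foldCBar : CBar →L[ℝ] CBar :=
  compCBar ⟨fun x => |x|, by fun_prop⟩ (fun f => by
    obtain ⟨⟨a, ha⟩, ⟨b, hb⟩⟩ := f.2
    exact ⟨⟨a, ha.comp tendsto_abs_atTop_atTop⟩, ⟨a, ha.comp tendsto_abs_atBot_atTop⟩⟩) -
  compCBar ⟨fun x => -|x|, by fun_prop⟩ fun f => by
    obtain ⟨⟨a, ha⟩, ⟨b, hb⟩⟩ := f.2
    exact ⟨⟨b, hb.comp (tendsto_neg_atTop_atBot.comp tendsto_abs_atTop_atTop)⟩,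
      ⟨b, hb.comp (tendsto_neg_atTop_atBot.comp tendsto_abs_atBot_atTop)⟩⟩

/-- The change of variables that turns the heat semigroup into the skew semigroup. -/
noncomputable def skewCBar (k : ℝ) : CBar →L[ℝ] CBar :=
  ContinuousLinearMap.id ℝ CBar + k • foldCBar

theorem skewCBar_apply (k : ℝ) (f : CBar) (x : ℝ) :
    (skewCBar k f).1 x = f.1 x + k * (f.1 |x| - f.1 (-|x|)) := rfl

/-- The fold is nilpotent of order two, since it sees only `|x|` and produces even functions. -/
theorem skewCBar_comp_neg (k : ℝ) :
    (skewCBar k).comp (skewCBar (-k)) = ContinuousLinearMap.id ℝ CBar := by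
  ext f x
  change (skewCBar k (skewCBar (-k) f)).1 x = f.1 x
  simp only [skewCBar_apply, abs_abs, abs_neg]
  ring

theorem isBoundedGroup_translCBar : IsBoundedGroup translCBar 1 where
  zero := by
    ext f x
    change (translCBar 0 f).1 x = f.1 x
    simp [translCBar_apply]
  add s t := by
    ext f x
    change (translCBar (s + t) f).1 x = (translCBar s (translCBar t f)).1 x
    simp [translCBar_apply, add_assoc]
  bound _ := norm_compCBar_le _ _
  cont f := by
    refine Metric.continuous_iff.2 fun s ε hε => ?_
    obtain ⟨δ, hδ, h⟩ := Metric.uniformContinuous_iff.1 (uniformContinuous_cBar f) (ε / 2)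
      (by positivity)
    refine ⟨δ, hδ, fun r hr => ?_⟩
    refine ((BoundedContinuousFunction.dist_le (by positivity : 0 ≤ ε / 2)).2
      fun x => ?_).trans_lt (half_lt_self hε)
    exact (h (by simpa using hr)).le

/-- The group whose cosine family is the dual cosine family, `k = (q - p) / (2 (p + q))`. -/
noncomputable def groupCBar (k s : ℝ) : CBar →L[ℝ] CBar :=
  (skewCBar k).comp ((translCBar s).comp (skewCBar (-k)))

theorem isBoundedGroup_groupCBar (k : ℝ) :
    IsBoundedGroup (groupCBar k) (‖skewCBar k‖ * (1 * ‖skewCBar (-k)‖)) :=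
  isBoundedGroup_translCBar.conj (skewCBar_comp_neg k) (by simpa using skewCBar_comp_neg (-k))

/-- Evaluation at `x`. -/
noncomputable def evalCBar (x : ℝ) : CBar →L[ℝ] ℝ :=
  (BoundedContinuousFunction.evalCLM ℝ x).comp CBar.subtypeL

theorem evalCBar_apply (x : ℝ) (f : CBar) : evalCBar x f = f.1 x := rfl

theorem skewCBar_neg_groupCBar (k s : ℝ) (f : CBar) :
    skewCBar (-k) (groupCBar k s f) = translCBar s (skewCBar (-k) f) := by
  have h : ∀ g, skewCBar (-k) (skewCBar k g) = g := fun g => by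
    have := congrArg (fun L => L g) (skewCBar_comp_neg (-k))
    rwa [neg_neg] at this
  exact h _

variable {p q : ℝ}

/-- Evaluating the conjugated orbit at `0` shows that `skewCBar (-k) w` is an ordinary `C²` function
on the line. On each half-line `w` is a combination of this function and its reflection, so
smoothness and one-sided derivatives can be read off. -/
theorem dualDelta_of_hasDerivAt (hpq : p + q ≠ 0) {w w₁ u : CBar}
    (h₁ : ∀ s, HasDerivAt (fun s => groupCBar ((q - p) / (2 * (p + q))) s w)
      (groupCBar ((q - p) / (2 * (p + q))) s w₁) s)
    (h₂ : ∀ s, HasDerivAt (fun s => groupCBar ((q - p) / (2 * (p + q))) s w₁)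
      (groupCBar ((q - p) / (2 * (p + q))) s u) s) : DualDelta p q w u := by
  set k := (q - p) / (2 * (p + q)) with hk
  have hinv : ∀ g, skewCBar k (skewCBar (-k) g) = g :=
    fun g => congrArg (fun L => L g) (skewCBar_comp_neg k)
  have red : ∀ {a b : CBar}, (∀ s, HasDerivAt (fun s => groupCBar k s a) (groupCBar k s b) s) →
      ∀ s, HasDerivAt (skewCBar (-k) a).1 ((skewCBar (-k) b).1 s) s := by
    intro a b h s
    have := ((evalCBar 0).comp (skewCBar (-k))).hasFDerivAt.comp_hasDerivAt s (h s)
    simp only [Function.comp_def, ContinuousLinearMap.comp_apply, skewCBar_neg_groupCBar,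
      evalCBar_apply, translCBar_apply, zero_add] at this
    exact this
  have d₁ := red h₁
  have d₂ := red h₂
  have ew := hinv w
  have eu := hinv u
  generalize skewCBar (-k) w = h at *
  generalize skewCBar (-k) w₁ = h' at *
  generalize skewCBar (-k) u = m at *
  have dneg : ∀ {a b : ℝ → ℝ}, (∀ s, HasDerivAt a (b s) s) →
      ∀ s, HasDerivAt (fun s => a (-s)) (-b (-s)) s := fun hab s => by
    simpa [Function.comp_def] using (hab (-s)).comp s (hasDerivAt_neg s)
  have R := contDiffOn_two_of_eqOn (uniqueDiffOn_Ici 0) (f := w.1)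
    (F := fun x => (1 + k) * h.1 x - k * h.1 (-x))
    (F₁ := fun x => (1 + k) * h'.1 x - k * (-h'.1 (-x)))
    (F₂ := fun x => (1 + k) * m.1 x - k * (- -m.1 (-x)))
    (fun x hx => by
      rw [← ew, skewCBar_apply, abs_of_nonneg (mem_Ici.1 hx)]
      ring)
    (fun x => ((d₁ x).const_mul _).sub ((dneg d₁ x).const_mul _))
    (fun x => ((d₂ x).const_mul _).sub ((dneg d₂ x).neg.const_mul _)) (by fun_prop)
  have L := contDiffOn_two_of_eqOn (uniqueDiffOn_Iic 0) (f := w.1)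
    (F := fun x => (1 - k) * h.1 x + k * h.1 (-x))
    (F₁ := fun x => (1 - k) * h'.1 x + k * (-h'.1 (-x)))
    (F₂ := fun x => (1 - k) * m.1 x + k * (- -m.1 (-x)))
    (fun x hx => by
      rw [← ew, skewCBar_apply, abs_of_nonpos (mem_Iic.1 hx), neg_neg]
      ring)
    (fun x => ((d₁ x).const_mul _).add ((dneg d₁ x).const_mul _))
    (fun x => ((d₂ x).const_mul _).add ((dneg d₂ x).neg.const_mul _)) (by fun_prop)
  refine ⟨L.1, R.1, ?_, fun x hx => ?_, fun x hx => ?_⟩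
  · rw [R.2.1 0 self_mem_Ici, L.2.1 0 self_mem_Iic, neg_zero, hk]
    field_simp
    ring
  · rw [L.2.2 x hx, ← eu, skewCBar_apply, abs_of_nonpos hx]
    simp only [neg_neg]
    ring
  · rw [R.2.2 x hx, ← eu, skewCBar_apply, abs_of_nonneg hx]
    ring

theorem DualDelta.sub {v u v' u' : CBar} (h : DualDelta p q v u) (h' : DualDelta p q v' u') :
    DualDelta p q (v - v') (u - u') := by
  obtain ⟨a1, a2, a3, a4, a5⟩ := h
  obtain ⟨b1, b2, b3, b4, b5⟩ := h'
  have e : ((v - v' : CBar).1 : ℝ → ℝ) = (v.1 : ℝ → ℝ) - (v'.1 : ℝ → ℝ) := rfl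
  have e' : ∀ x, (u - u' : CBar).1 x = u.1 x - u'.1 x := fun x => rfl
  refine ⟨?_, ?_, ?_, fun x hx => ?_, fun x hx => ?_⟩
  · rw [e]; exact a1.sub b1
  · rw [e]; exact a2.sub b2
  · rw [e, derivWithin_sub (a2.differentiableOn (by simp) 0 self_mem_Ici)
      (b2.differentiableOn (by simp) 0 self_mem_Ici),
      derivWithin_sub (a1.differentiableOn (by simp) 0 self_mem_Iic)
      (b1.differentiableOn (by simp) 0 self_mem_Iic)]
    linarith
  · rw [e, iteratedDerivWithin_sub (s := Iic 0) hx (uniqueDiffOn_Iic (0 : ℝ)) (a1 x hx) (b1 x hx),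
      a4 x hx, b4 x hx, e']
  · rw [e, iteratedDerivWithin_sub (s := Ici 0) hx (uniqueDiffOn_Ici 0) (a2 x hx) (b2 x hx),
      a5 x hx, b5 x hx, e']

theorem DualDelta.eq_zero (hpq : p + q ≠ 0) {z : CBar} (h : DualDelta p q z ((2 : ℝ) • z)) :
    z = 0 := by
  obtain ⟨a1, a2, a3, a4, a5⟩ := h
  have nb : ∀ φ : ℝ → ℝ, ¬ Tendsto (fun x => |z.1 (φ x)|) atTop atTop := by
    intro φ ht
    obtain ⟨x, hx⟩ := (ht.eventually_gt_atTop ‖z.1‖).exists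
    exact absurd (z.1.norm_coe_le_norm (φ x)) (not_le.2 hx)
  have R := eq_exp_of_deriv_deriv_eq (Z := z.1) (Z₁ := derivWithin z.1 (Ici 0))
    (fun x hx => (ContDiffOn.hasDerivWithinAt_derivWithin (uniqueDiffOn_Ici 0) a2 hx).1)
    (fun x hx => by
      have := (ContDiffOn.hasDerivWithinAt_derivWithin (uniqueDiffOn_Ici 0) a2 hx).2
      rwa [a5 x hx] at this) (nb id)
  have maps : MapsTo (fun x : ℝ => -x) (Ici 0) (Iic 0) := fun x hx => by
    simpa using hx
  have L := eq_exp_of_deriv_deriv_eq (Z := fun x => z.1 (-x))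
    (Z₁ := fun x => -derivWithin z.1 (Iic 0) (-x))
    (fun x hx => by
      have h1 := (ContDiffOn.hasDerivWithinAt_derivWithin (uniqueDiffOn_Iic 0) a1
        (maps (mem_Ici.2 hx))).1
      simpa [Function.comp_def] using h1.comp x (hasDerivAt_neg x).hasDerivWithinAt maps)
    (fun x hx => by
      have h1 := (ContDiffOn.hasDerivWithinAt_derivWithin (uniqueDiffOn_Iic 0) a1
        (maps (mem_Ici.2 hx))).2
      rw [a4 _ (maps (mem_Ici.2 hx))] at h1
      refine HasDerivWithinAt.congr_deriv
        (h1.comp x (hasDerivAt_neg x).hasDerivWithinAt maps).neg ?_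
      change -(2 * z.1 (-x) * -1) = 2 * z.1 (-x)
      ring)
    (nb _)
  -- The decaying exponentials have slopes `-√2 z(0)` at `0+` and `√2 z(0)` at `0-`, so the
  -- transmission condition reads `(p + q) √2 z(0) = 0`.
  have hz : z.1 0 = 0 := by
    have l1 := L.1
    simp only [neg_zero] at l1
    rw [R.1, show derivWithin z.1 (Iic 0) 0 = √2 * z.1 0 by linarith] at a3
    have : (p + q) * (√2 * z.1 0) = 0 := by linarith
    simpa [hpq] using this
  ext x
  change z.1 x = 0
  rcases le_total 0 x with hx | hx
  · rw [R.2 x hx, hz, zero_mul]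
  · have := L.2 (-x) (by linarith)
    simpa [hz] using this

theorem isGeneratedBy_dualDelta (hpq : p + q ≠ 0) :
    IsGeneratedBy (isBoundedGroup_groupCBar ((q - p) / (2 * (p + q)))).gaussian
      (Half (DualDelta p q)) ∧ ∀ v, ∃ w, Half (DualDelta p q) w (w - v) :=
  IsBoundedGroup.isGeneratedBy_gaussian _ (fun _ _ _ => dualDelta_of_hasDerivAt hpq)
    (fun _ _ _ _ => DualDelta.sub) fun _ => DualDelta.eq_zero hpq

end ContinuousFunctions

/-! ### The kernels and their positivity -/

section Kernels

/-- The sign function, with value `-1` at `0`. -/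
noncomputable def sgn (x : ℝ) : ℝ := if 0 < x then 1 else -1

theorem sgn_of_pos {x : ℝ} (hx : 0 < x) : sgn x = 1 := if_pos hx

theorem sgn_of_nonpos {x : ℝ} (hx : x ≤ 0) : sgn x = -1 := if_neg (not_lt.2 hx)

theorem sgn_neg {x : ℝ} (hx : x ≠ 0) : sgn (-x) = -sgn x := by
  rcases lt_or_gt_of_ne hx with h | h
  · rw [sgn_of_pos (by linarith), sgn_of_nonpos h.le, neg_neg]
  · rw [sgn_of_pos h, sgn_of_nonpos (by linarith)]

theorem measurable_sgn : Measurable sgn :=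
  Measurable.ite measurableSet_Ioi measurable_const measurable_const

theorem norm_sgn_le (x : ℝ) : ‖sgn x‖ ≤ 1 := by
  unfold sgn
  split_ifs <;> simp

theorem ae_ne_zero : ∀ᵐ x : ℝ, x ≠ 0 := by
  simp [ae_iff, measure_singleton]

theorem Integrable.sgn_mul {f : ℝ → ℝ} (hf : Integrable f) : Integrable fun x => sgn x * f x :=
  hf.bdd_mul measurable_sgn.aestronglyMeasurable (ae_of_all _ norm_sgn_le)

/-- Transposes the skew operators: the substitution `z ↦ -z` moves the reflection from `f` to `K`,
and the sign function changes sign. The coefficients `a` and `k` are independent because the two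
spaces need opposite and equal ones respectively. -/
theorem integral_mul_fold {K f : ℝ → ℝ} (a k : ℝ) (h₁ : Integrable fun z => K z * f z)
    (h₂ : Integrable fun z => K (-z) * f z) :
    Integrable (fun z => (K z * (1 + a * sgn z) - k * sgn z * K (-z)) * f z) ∧
    ∫ z, K z * (f z + a * sgn z * f z + k * sgn z * f (-z)) =
      ∫ z, (K z * (1 + a * sgn z) - k * sgn z * K (-z)) * f z := by
  have i₁ : Integrable fun z => K z * (1 + a * sgn z) * f z := by
    refine (h₁.add ((Integrable.sgn_mul h₁).const_mul a)).congr (ae_of_all _ fun z => ?_)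
    simp only [Pi.add_apply]
    ring
  have i₂ : Integrable fun z => k * sgn z * K (-z) * f z := by
    refine ((Integrable.sgn_mul h₂).const_mul k).congr (ae_of_all _ fun z => ?_)
    simp only
    ring
  have i₃ : Integrable fun z => -(k * sgn (-z) * K z * f (-z)) := by
    refine i₂.comp_neg.neg.congr (ae_of_all _ fun z => ?_)
    simp
  have e : ∫ z, -(k * sgn (-z) * K z * f (-z)) = -∫ z, k * sgn z * K (-z) * f z := by
    rw [integral_neg, ← integral_neg_eq_self (fun z => k * sgn z * K (-z) * f z)]
    simp
  constructor
  · refine (i₁.sub i₂).congr (ae_of_all _ fun z => ?_)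
    simp only [Pi.sub_apply]
    ring
  · calc ∫ z, K z * (f z + a * sgn z * f z + k * sgn z * f (-z))
        = ∫ z, (K z * (1 + a * sgn z) * f z + -(k * sgn (-z) * K z * f (-z))) := by
          refine integral_congr_ae ?_
          filter_upwards [ae_ne_zero] with z hz
          rw [sgn_neg hz]
          ring
      _ = (∫ z, K z * (1 + a * sgn z) * f z) - ∫ z, k * sgn z * K (-z) * f z := by
          rw [integral_add i₁ i₃, e, sub_eq_add_neg]
      _ = _ := by
          rw [← integral_sub i₁ i₂]
          congr 1
          ext z
          ring

/-- The Gaussian density with mean `0` and variance `t`. -/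
noncomputable def heatKernel (t y : ℝ) : ℝ :=
  1 / √(2 * Real.pi * t) * Real.exp (-y ^ 2 / (2 * t))

theorem heatKernel_neg (t y : ℝ) : heatKernel t (-y) = heatKernel t y := by
  simp [heatKernel]

theorem heatKernel_nonneg (t y : ℝ) : 0 ≤ heatKernel t y := by
  unfold heatKernel
  positivity

theorem gaussianPDFReal_eq_heatKernel {t : ℝ} (ht : 0 < t) (y : ℝ) :
    ProbabilityTheory.gaussianPDFReal 0 t.toNNReal y = heatKernel t y := by
  simp [ProbabilityTheory.gaussianPDFReal, heatKernel, ht.le]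

theorem continuous_heatKernel (t : ℝ) : Continuous (heatKernel t) := by
  unfold heatKernel
  fun_prop

theorem integrable_heatKernel {t : ℝ} (ht : 0 < t) : Integrable (heatKernel t) := by
  refine (ProbabilityTheory.integrable_gaussianPDFReal 0 t.toNNReal).congr
    (ae_of_all _ (gaussianPDFReal_eq_heatKernel ht))

theorem integral_gaussianReal_eq {E : Type*} [NormedAddCommGroup E] [NormedSpace ℝ E] {t : ℝ}
    (ht : 0 < t) (F : ℝ → E) :
    ∫ y, F y ∂(ProbabilityTheory.gaussianReal 0 t.toNNReal) = ∫ y, heatKernel t y • F y := by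
  rw [ProbabilityTheory.integral_gaussianReal_eq_integral_smul (by simpa using ht)]
  simp only [gaussianPDFReal_eq_heatKernel ht]

theorem heatKernel_le (t y : ℝ) (ht : 0 < t) : heatKernel t y ≤ 1 / √(2 * Real.pi * t) := by
  unfold heatKernel
  refine mul_le_of_le_one_right (by positivity) (Real.exp_le_one_iff.2 ?_)
  rw [neg_div]
  have : 0 ≤ y ^ 2 / (2 * t) := by positivity
  linarith

/-- The common form of the kernels `γ⁺` and `γ⁻`. -/
noncomputable def skewKernel (k t x y : ℝ) : ℝ :=
  (1 + k * (sgn x - sgn y)) * heatKernel t (y - x) - k * (sgn x + sgn y) * heatKernel t (y + x)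

variable {p q : ℝ}

theorem gammaPlus_eq (hpq : p + q ≠ 0) (t : ℝ) {x : ℝ} (hx : 0 < x) (y : ℝ) :
    gammaPlus p q t x y = skewKernel ((q - p) / (2 * (p + q))) t x y := by
  unfold gammaPlus skewKernel heatKernel
  rw [sgn_of_pos hx]
  split_ifs with hy
  · rw [sgn_of_pos hy]
    field_simp
    ring
  · rw [sgn_of_nonpos (not_lt.1 hy)]
    field_simp
    ring

/-- The point `y = 0` must be excluded: there `gammaMinus` takes its value from the positive side,
while `sgn 0 = -1`. For `gammaPlus` the two conventions agree. -/
theorem gammaMinus_eq (hpq : p + q ≠ 0) (t : ℝ) {x y : ℝ} (hx : x < 0) (hy : y ≠ 0) :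
    gammaMinus p q t x y = skewKernel ((q - p) / (2 * (p + q))) t x y := by
  unfold gammaMinus skewKernel heatKernel
  rw [sgn_of_nonpos hx.le]
  split_ifs with h
  · rw [sgn_of_nonpos h.le]
    field_simp
    ring
  · rw [sgn_of_pos (lt_of_le_of_ne (not_lt.1 h) hy.symm)]
    field_simp
    ring

theorem gamma_eq (hpq : p + q ≠ 0) (t : ℝ) {x y : ℝ} (hx : x ≠ 0) (hy : y ≠ 0) :
    gamma p q t x y = skewKernel ((q - p) / (2 * (p + q))) t x y := by
  unfold gamma
  split_ifs with h
  · exact gammaPlus_eq hpq t h y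
  · exact gammaMinus_eq hpq t (lt_of_le_of_ne (not_lt.1 h) hx) hy

/-- For `x` and `y` on the same side of `0` the mirror image is the more distant point. As the
reflected term has coefficient at least `-1`, the kernels are nonnegative. -/
theorem reflected_exp_le {t x y : ℝ} (ht : 0 < t) (h : 0 ≤ x * y) :
    Real.exp (-(y + x) ^ 2 / (2 * t)) ≤ Real.exp (-(y - x) ^ 2 / (2 * t)) := by
  exact Real.exp_le_exp.2 (div_le_div_of_nonneg_right (by nlinarith) (by positivity))

theorem gammaPlus_nonneg (hp : 0 ≤ p) (hq : 0 ≤ q) (hpq : 0 < p + q) {t x : ℝ} (ht : 0 < t)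
    (hx : 0 < x) (y : ℝ) : 0 ≤ gammaPlus p q t x y := by
  unfold gammaPlus
  split_ifs with hy
  · have h1 := reflected_exp_le ht (mul_pos hx hy).le
    have h2 : -1 ≤ (p - q) / (p + q) := by
      rw [le_div_iff₀ hpq]
      linarith
    have h3 := Real.exp_pos (-(y + x) ^ 2 / (2 * t))
    refine mul_nonneg (by positivity) ?_
    nlinarith
  · positivity

theorem gammaMinus_nonneg (hp : 0 ≤ p) (hq : 0 ≤ q) (hpq : 0 < p + q) {t x : ℝ} (ht : 0 < t)
    (hx : x < 0) (y : ℝ) : 0 ≤ gammaMinus p q t x y := by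
  unfold gammaMinus
  split_ifs with hy
  · have h1 := reflected_exp_le ht (mul_pos_of_neg_of_neg hx hy).le
    have h2 : -1 ≤ (q - p) / (p + q) := by
      rw [le_div_iff₀ hpq]
      linarith
    have h3 := Real.exp_pos (-(y + x) ^ 2 / (2 * t))
    refine mul_nonneg (by positivity) ?_
    nlinarith
  · positivity

end Kernels

/-! ### Weierstrass formula and kernel representation in `C[-∞,+∞]` -/

section ContinuousFormulas

/-! The structures on `C[-∞,+∞]` that come from its norm; they agree by definition with those of a
submodule, and the elaborator has to be told which to prefer. -/

attribute [local instance] normAddCommGroupCBar normAddCommMonoidCBar normTopologyCBar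
  normModuleCBar

theorem groupCBar_apply (k s : ℝ) (f : CBar) (x : ℝ) : (groupCBar k s f).1 x =
    (skewCBar (-k) f).1 (x + s) + k * ((skewCBar (-k) f).1 (|x| + s) -
      (skewCBar (-k) f).1 (-|x| + s)) := rfl

theorem skewCBar_apply_of_nonneg (k : ℝ) (f : CBar) {x : ℝ} (hx : 0 ≤ x) :
    (skewCBar k f).1 x = (1 + k) * f.1 x - k * f.1 (-x) := by
  rw [skewCBar_apply, abs_of_nonneg hx]
  ring

theorem skewCBar_apply_of_nonpos (k : ℝ) (f : CBar) {x : ℝ} (hx : x ≤ 0) :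
    (skewCBar k f).1 x = (1 - k) * f.1 x + k * f.1 (-x) := by
  rw [skewCBar_apply, abs_of_nonpos hx, neg_neg]
  ring

theorem skewCBar_apply_eq (k : ℝ) (f : CBar) (x : ℝ) :
    (skewCBar k f).1 x = f.1 x + k * sgn x * f.1 x + -k * sgn x * f.1 (-x) := by
  rcases lt_or_ge 0 x with hx | hx
  · rw [skewCBar_apply_of_nonneg k f hx.le, sgn_of_pos hx]
    ring
  · rw [skewCBar_apply_of_nonpos k f hx, sgn_of_nonpos hx]
    ring

/-- The dual cosine family is the cosine part of the group. -/
theorem dualCosine_eq (p q : ℝ) {s : ℝ} (hs : 0 ≤ s) (f : CBar) (x : ℝ) :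
    dualCosine p q s f.1 x = ((groupCBar ((q - p) / (2 * (p + q))) s f).1 x +
      (groupCBar ((q - p) / (2 * (p + q))) (-s) f).1 x) / 2 := by
  have hk : (p - q) / (2 * (p + q)) = -((q - p) / (2 * (p + q))) := by
    rw [← neg_div, neg_sub]
  unfold dualCosine
  rw [hk]
  generalize (q - p) / (2 * (p + q)) = k
  have a1 : x + -s = x - s := rfl
  have a2 : -x + s = -(x - s) := by ring
  have a3 : -x + -s = -(x + s) := by ring
  have a4 : s - x = -(x - s) := by ring
  have a5 : -x - s = -(x + s) := by ring
  -- Each case fixes the signs of `x + s` and `x - s`, hence the branch of the skew operator at `±(x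
  -- + s)` and `±(x - s)`.
  split_ifs with h1 h2
  · rcases le_total 0 x with hx | hx
    · rw [abs_of_nonneg hx] at h1
      rw [groupCBar_apply, groupCBar_apply, abs_of_nonneg hx, a1, a2, a3,
        skewCBar_apply_of_nonneg _ f (by linarith : 0 ≤ x + s),
        skewCBar_apply_of_nonneg _ f (by linarith : 0 ≤ x - s),
        skewCBar_apply_of_nonpos _ f (by linarith : -(x + s) ≤ 0),
        skewCBar_apply_of_nonpos _ f (by linarith : -(x - s) ≤ 0), neg_neg, neg_neg]
      ring
    · rw [abs_of_nonpos hx] at h1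
      rw [groupCBar_apply, groupCBar_apply, abs_of_nonpos hx, neg_neg, a1, a2, a3,
        skewCBar_apply_of_nonpos _ f (by linarith : x + s ≤ 0),
        skewCBar_apply_of_nonpos _ f (by linarith : x - s ≤ 0),
        skewCBar_apply_of_nonneg _ f (by linarith : 0 ≤ -(x + s)),
        skewCBar_apply_of_nonneg _ f (by linarith : 0 ≤ -(x - s)), neg_neg, neg_neg]
      ring
  · rw [abs_of_nonpos h2] at h1
    rw [groupCBar_apply, groupCBar_apply, abs_of_nonpos h2, neg_neg, a1, a2, a3, a5,
      skewCBar_apply_of_nonneg _ f (by linarith : 0 ≤ x + s),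
      skewCBar_apply_of_nonpos _ f (by linarith : x - s ≤ 0),
      skewCBar_apply_of_nonpos _ f (by linarith : -(x + s) ≤ 0),
      skewCBar_apply_of_nonneg _ f (by linarith : 0 ≤ -(x - s)), neg_neg, neg_neg]
    ring
  · rw [abs_of_nonneg (by linarith : 0 ≤ x)] at h1
    rw [groupCBar_apply, groupCBar_apply, abs_of_nonneg (by linarith : 0 ≤ x), a1, a2, a3, a4,
      skewCBar_apply_of_nonneg _ f (by linarith : 0 ≤ x + s),
      skewCBar_apply_of_nonpos _ f (by linarith : x - s ≤ 0),
      skewCBar_apply_of_nonpos _ f (by linarith : -(x + s) ≤ 0),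
      skewCBar_apply_of_nonneg _ f (by linarith : 0 ≤ -(x - s)), neg_neg, neg_neg]
    ring

theorem gaussian_groupCBar_apply (k : ℝ) {t : ℝ} (ht : 0 < t) (f : CBar) (x : ℝ) :
    ((isBoundedGroup_groupCBar k).gaussian t f).1 x =
      ∫ y, heatKernel t y * (groupCBar k y f).1 x := by
  rw [IsBoundedGroup.gaussian_apply]
  have := (evalCBar x).integral_comp_comm ((isBoundedGroup_groupCBar k).integrable
    (ProbabilityTheory.gaussianReal 0 t.toNNReal) f)
  rw [← evalCBar_apply, ← this, integral_gaussianReal_eq ht]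
  rfl

theorem integrable_heatKernel_groupCBar (k : ℝ) {t : ℝ} (ht : 0 < t) (f : CBar) (x : ℝ) :
    Integrable fun y => heatKernel t y * (groupCBar k y f).1 x := by
  have := (evalCBar x).integrable_comp
    ((isBoundedGroup_groupCBar k).integrable_smul (integrable_heatKernel ht) f)
  exact this

theorem weierstrass_formula (p q : ℝ) {t : ℝ} (ht : 0 < t) (f : CBar) (x : ℝ) :
    IntegrableOn (fun s => Real.exp (-s ^ 2 / (2 * t)) * dualCosine p q s f.1 x) (Ioi 0) ∧
    ((isBoundedGroup_groupCBar ((q - p) / (2 * (p + q)))).gaussian t f).1 x =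
      √(2 / (Real.pi * t)) *
        ∫ s in Ioi (0 : ℝ), Real.exp (-s ^ 2 / (2 * t)) * dualCosine p q s f.1 x := by
  set k := (q - p) / (2 * (p + q)) with hk
  have hi := integrable_heatKernel_groupCBar k ht f x
  set F := fun y => heatKernel t y * (groupCBar k y f).1 x with hF
  have hπ : 0 < √(2 * Real.pi * t) := by positivity
  -- The Gaussian integral is folded onto `s > 0`. The factor removes the normalisation of the heat
  -- kernel and supplies the `1/2` of the cosine mean.
  have e : ∀ s ∈ Ioi (0 : ℝ), (√(2 * Real.pi * t) / 2) * (F s + F (-s)) =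
      Real.exp (-s ^ 2 / (2 * t)) * dualCosine p q s f.1 x := by
    intro s hs
    rw [dualCosine_eq p q (le_of_lt hs), hF]
    simp only [heatKernel_neg]
    unfold heatKernel
    field_simp
    ring
  have hi2 : IntegrableOn (fun s => F s + F (-s)) (Ioi 0) := (hi.add hi.comp_neg).integrableOn
  refine ⟨IntegrableOn.congr_fun (Integrable.const_mul hi2 _) e measurableSet_Ioi, ?_⟩
  rw [gaussian_groupCBar_apply k ht, ← setIntegral_congr_fun measurableSet_Ioi e,
    integral_const_mul, integral_add hi.integrableOn hi.comp_neg.integrableOn,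
    integral_comp_neg_Ioi, neg_zero, add_comm, intervalIntegral.integral_Iic_add_Ioi
      hi.integrableOn hi.integrableOn, ← mul_assoc]
  have : √(2 / (Real.pi * t)) * (√(2 * Real.pi * t) / 2) = 1 := by
    rw [← mul_div_assoc, ← Real.sqrt_mul (by positivity),
      show 2 / (Real.pi * t) * (2 * Real.pi * t) = 2 ^ 2 by field_simp,
      Real.sqrt_sq (by norm_num)]
    norm_num
  rw [this, one_mul]

theorem integrable_mul_cBar {K : ℝ → ℝ} (hK : Integrable K) (f : CBar) :
    Integrable fun z => K z * f.1 z :=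
  hK.mul_bdd f.1.continuous.aestronglyMeasurable (ae_of_all _ fun z => f.1.norm_coe_le_norm z)

theorem gaussian_groupCBar_eq_integral_skewKernel (k : ℝ) {t : ℝ} (ht : 0 < t) (f : CBar) {x : ℝ} :
    Integrable (fun y => skewKernel k t x y * f.1 y) ∧
    ((isBoundedGroup_groupCBar k).gaussian t f).1 x = ∫ y, skewKernel k t x y * f.1 y := by
  have hg := integrable_heatKernel ht
  set h := skewCBar (-k) f with hh
  -- The outer skew operator, evaluated at `x`, only combines the heat kernels centred at `x` and
  -- `-x`. The inner one is transposed onto `K` by `integral_mul_fold`.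
  set K : ℝ → ℝ := fun z => (1 + k * sgn x) * heatKernel t (z - x) -
    k * sgn x * heatKernel t (z + x) with hK
  have iK : Integrable K :=
    ((hg.comp_sub_right x).const_mul _).sub ((hg.comp_add_right x).const_mul _)
  have shift : ∀ c : ℝ, Integrable (fun y => heatKernel t y * h.1 (c + y)) ∧
      ∫ y, heatKernel t y * h.1 (c + y) = ∫ z, heatKernel t (z - c) * h.1 z := by
    intro c
    have i := integrable_mul_cBar (hg.comp_sub_right c) h
    constructor
    · simpa [add_comm] using i.comp_add_right c
    · rw [← integral_add_right_eq_self (fun z => heatKernel t (z - c) * h.1 z) c]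
      simp [add_comm]
  have e1 : ((isBoundedGroup_groupCBar k).gaussian t f).1 x = ∫ z, K z * h.1 z := by
    rw [gaussian_groupCBar_apply k ht]
    have e : ∀ y, heatKernel t y * (groupCBar k y f).1 x =
        (1 + k * sgn x) * (heatKernel t y * h.1 (x + y)) -
          k * sgn x * (heatKernel t y * h.1 (-x + y)) := by
      intro y
      rw [groupCBar_apply]
      rcases lt_or_ge 0 x with hx | hx
      · rw [abs_of_pos hx, sgn_of_pos hx]
        ring
      · rw [abs_of_nonpos hx, sgn_of_nonpos hx, neg_neg]
        ring
    simp only [e]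
    rw [integral_sub ((shift x).1.const_mul _) ((shift (-x)).1.const_mul _), integral_const_mul,
      integral_const_mul, (shift x).2, (shift (-x)).2, ← integral_const_mul, ← integral_const_mul,
      ← integral_sub ((integrable_mul_cBar (hg.comp_sub_right x) h).const_mul _)
        ((integrable_mul_cBar (hg.comp_sub_right (-x)) h).const_mul _)]
    congr 1
    ext z
    simp only [hK, sub_neg_eq_add]
    ring
  have h2 := integral_mul_fold (K := K) (f := f.1) (-k) (- -k) (integrable_mul_cBar iK f)
    (integrable_mul_cBar iK.comp_neg f)
  have e3 : ∀ z, K z * (1 + -k * sgn z) - - -k * sgn z * K (-z) = skewKernel k t x z := by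
    intro z
    have b1 : heatKernel t (-z - x) = heatKernel t (z + x) := by
      rw [← heatKernel_neg, neg_sub, sub_neg_eq_add, add_comm]
    have b2 : heatKernel t (-z + x) = heatKernel t (z - x) := by
      rw [← heatKernel_neg, neg_add, neg_neg, sub_eq_add_neg]
    simp only [hK, skewKernel, b1, b2]
    ring
  simp only [e3] at h2
  refine ⟨h2.1, ?_⟩
  rw [e1, ← h2.2]
  congr 1
  ext z
  rw [hh, skewCBar_apply_eq]

/-- The constant function `1`. -/
noncomputable def oneCBar : CBar :=
  ⟨BoundedContinuousFunction.const ℝ 1, ⟨1, tendsto_const_nhds⟩, ⟨1, tendsto_const_nhds⟩⟩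

/-- The fold annihilates constants, so the group fixes the function `1`; hence the kernel has total
mass one. -/
theorem integral_skewKernel (k : ℝ) {t : ℝ} (ht : 0 < t) (x : ℝ) :
    Integrable (skewKernel k t x) ∧ ∫ y, skewKernel k t x y = 1 := by
  have h := gaussian_groupCBar_eq_integral_skewKernel k ht oneCBar (x := x)
  have h1 : ∀ y, oneCBar.1 y = 1 := fun _ => rfl
  have h2 : ∀ y, (groupCBar k y oneCBar).1 x = 1 := fun y => by
    simp only [groupCBar_apply, skewCBar_apply, h1]
    ring
  have h3 : ∫ y, heatKernel t y = 1 := by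
    simpa using (integral_gaussianReal_eq ht (fun _ => (1 : ℝ))).symm
  rw [gaussian_groupCBar_apply k ht] at h
  simp only [h1, h2, mul_one, h3] at h
  exact ⟨h.1, h.2.symm⟩

variable {p q : ℝ}

theorem integrable_gammaPlus_mul (hpq : p + q ≠ 0) {t x : ℝ} (ht : 0 < t) (hx : 0 < x) (f : CBar) :
    Integrable (fun y => gammaPlus p q t x y * f.1 y) ∧
      ((isBoundedGroup_groupCBar ((q - p) / (2 * (p + q)))).gaussian t f).1 x =
        ∫ y, gammaPlus p q t x y * f.1 y := by
  simp only [gammaPlus_eq hpq t hx]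
  exact gaussian_groupCBar_eq_integral_skewKernel _ ht f

theorem integrable_gammaMinus_mul (hpq : p + q ≠ 0) {t x : ℝ} (ht : 0 < t) (hx : x < 0) (f : CBar) :
    Integrable (fun y => gammaMinus p q t x y * f.1 y) ∧
      ((isBoundedGroup_groupCBar ((q - p) / (2 * (p + q)))).gaussian t f).1 x =
        ∫ y, gammaMinus p q t x y * f.1 y := by
  have h := gaussian_groupCBar_eq_integral_skewKernel ((q - p) / (2 * (p + q))) ht f (x := x)
  have e : (fun y => gammaMinus p q t x y * f.1 y) =ᵐ[volume]
      fun y => skewKernel ((q - p) / (2 * (p + q))) t x y * f.1 y := by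
    filter_upwards [ae_ne_zero] with y hy
    rw [gammaMinus_eq hpq t hx hy]
  exact ⟨h.1.congr e.symm, h.2.trans (integral_congr_ae e).symm⟩

theorem integral_gammaPlus (hpq : p + q ≠ 0) {t x : ℝ} (ht : 0 < t) (hx : 0 < x) :
    Integrable (gammaPlus p q t x) ∧ ∫ y, gammaPlus p q t x y = 1 := by
  rw [show gammaPlus p q t x = _ from funext (gammaPlus_eq hpq t hx)]
  exact integral_skewKernel _ ht x

theorem integral_gammaMinus (hpq : p + q ≠ 0) {t x : ℝ} (ht : 0 < t) (hx : x < 0) :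
    Integrable (gammaMinus p q t x) ∧ ∫ y, gammaMinus p q t x y = 1 := by
  have h := integral_skewKernel ((q - p) / (2 * (p + q))) ht x
  have e : gammaMinus p q t x =ᵐ[volume] skewKernel ((q - p) / (2 * (p + q))) t x := by
    filter_upwards [ae_ne_zero] with y hy
    rw [gammaMinus_eq hpq t hx hy]
  exact ⟨h.1.congr e.symm, (integral_congr_ae e).trans h.2⟩

end ContinuousFormulas

/-! ### Transition densities of the Markov process -/

section Markov

/-- Integrate the Markov property at time `s = 0`, where the process sits at `x`. -/
theorem IsMarkovProcess.integral_eq {Ω : Type*} [MeasurableSpace Ω] {S : ℝ → CBar →L[ℝ] CBar}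
    {P : ℝ → Measure Ω} {w : ℝ → Ω → ℝ} (h : IsMarkovProcess S P w) {t : ℝ} (ht : 0 ≤ t) (x : ℝ)
    (f : CBar) : ∫ ω, f.1 (w t ω) ∂(P x) = (S t f).1 x := by
  have := h.prob x
  have hle : (⨆ r ∈ Icc (0 : ℝ) 0, MeasurableSpace.comap (w r) inferInstance) ≤
      ‹MeasurableSpace Ω› :=
    iSup₂_le fun r hr => (h.meas r hr.1).comap_le
  have h1 := integral_condExp (μ := P x) (f := fun ω => f.1 (w (0 + t) ω)) hle
  rw [integral_congr_ae (h.markov x 0 t le_rfl ht f)] at h1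
  rw [zero_add] at h1
  rw [← h1, integral_congr_ae (g := fun _ => (S t f).1 x)]
  · simp
  · filter_upwards [h.start x] with ω hω
    rw [hω]

/-- Laws are determined by their integrals of functions of `C[-∞,+∞]`. -/
theorem measure_eq_of_forall_integral_cBar {μ ν : Measure ℝ} [IsFiniteMeasure μ]
    [IsFiniteMeasure ν] (h : ∀ f : CBar, ∫ x, f.1 x ∂μ = ∫ x, f.1 x ∂ν) : μ = ν := by
  refine Measure.ext_of_integral_eq_on_compactlySupported fun f => ?_
  have h0 : Tendsto f (cocompact ℝ) (𝓝 0) := f.hasCompactSupport.is_zero_at_infty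
  rw [cocompact_eq_atBot_atTop, tendsto_sup] at h0
  obtain ⟨C, hC⟩ := f.hasCompactSupport.exists_bound_of_continuous f.continuous
  exact h ⟨BoundedContinuousFunction.ofNormedAddCommGroup f f.continuous C hC,
    ⟨0, h0.2⟩, ⟨0, h0.1⟩⟩

theorem IsMarkovProcess.map_eq_withDensity {Ω : Type*} [MeasurableSpace Ω]
    {S : ℝ → CBar →L[ℝ] CBar} {P : ℝ → Measure Ω} {w : ℝ → Ω → ℝ} (h : IsMarkovProcess S P w)
    {t : ℝ} (ht : 0 ≤ t) (x : ℝ) {g : ℝ → ℝ} (g0 : ∀ y, 0 ≤ g y) (gi : Integrable g)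
    (hg : ∀ f : CBar, (S t f).1 x = ∫ y, g y * f.1 y) :
    (P x).map (w t) = volume.withDensity fun y => ENNReal.ofReal (g y) := by
  have := h.prob x
  have hm := h.meas t ht
  have := isFiniteMeasure_withDensity_ofReal gi.2
  have : IsFiniteMeasure ((P x).map (w t)) := Measure.isFiniteMeasure_map _ _
  refine measure_eq_of_forall_integral_cBar fun f => ?_
  rw [integral_map hm.aemeasurable f.1.continuous.aestronglyMeasurable, h.integral_eq ht x f, hg f,
    integral_withDensity_eq_integral_toReal_smul₀ gi.aemeasurable.ennreal_ofReal
      (ae_of_all _ fun _ => ENNReal.ofReal_lt_top)]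
  simp [ENNReal.toReal_ofReal (g0 _)]

end Markov

/-! ### Integrated forms of differential equations for integrable functions -/

section IntegrableFunctions

theorem intervalIntegrable_sub_mul {ψ : ℝ → ℝ} (hψ : Integrable ψ) (x a b : ℝ) :
    IntervalIntegrable (fun y => (x - y) * ψ y) volume a b :=
  (hψ.intervalIntegrable).continuousOn_mul (by fun_prop)

/-- Cauchy's formula for the iterated integral. -/
theorem integral_integral_eq {ψ : ℝ → ℝ} (hψ : Integrable ψ) (x : ℝ) :
    ∫ y in (0 : ℝ)..x, ∫ r in (0 : ℝ)..y, ψ r = ∫ y in (0 : ℝ)..x, (x - y) * ψ y := by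
  have hi : IntervalIntegrable ψ volume 0 x := hψ.intervalIntegrable
  have hf : AbsolutelyContinuousOnInterval (fun y => ∫ r in (0 : ℝ)..y, ψ r) 0 x :=
    hi.absolutelyContinuousOnInterval_intervalIntegral (by simp)
  have hg : AbsolutelyContinuousOnInterval (fun y => x - y) 0 x :=
    ContDiffOn.absolutelyContinuousOnInterval (by fun_prop)
  -- Integration by parts; the boundary terms vanish because `x - y` is zero at `y = x` and the
  -- primitive is zero at `y = 0`.
  have h := hg.integral_mul_deriv_eq_deriv_mul hf
  have e1 : ∫ y in (0 : ℝ)..x, (x - y) * deriv (fun y => ∫ r in (0 : ℝ)..y, ψ r) y =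
      ∫ y in (0 : ℝ)..x, (x - y) * ψ y := by
    refine intervalIntegral.integral_congr_ae ?_
    filter_upwards [hi.ae_hasDerivAt_integral] with y hy hy2
    rw [(hy (uIoc_subset_uIcc hy2) 0 (by simp)).deriv]
  have e2 : ∀ y, deriv (fun y => x - y) y = -1 := fun y => by
    simp
  rw [e1] at h
  simp only [e2] at h
  rw [h]
  simp

/-- A function invariant under translations up to null sets is constant up to a null set. -/
theorem ae_eq_const_of_translation_invariant {d : ℝ → ℝ} (hd : AEStronglyMeasurable d)
    (h : ∀ s, ∀ᵐ x, d (x + s) = d x) : ∃ C, ∀ᵐ x, d x = C := by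
  set d' := hd.mk d with hd'
  have m' : Measurable d' := hd.stronglyMeasurable_mk.measurable
  have e : d =ᵐ[volume] d' := hd.ae_eq_mk
  have h1 : ∀ s, ∀ᵐ x, d' (x + s) = d' x := fun s => by
    filter_upwards [h s, e, (measurePreserving_add_right volume s).quasiMeasurePreserving.ae e]
      with x h1 h2 h3
    rw [← h3, ← h2, h1]
  -- Fubini exchanges the quantifiers; the measurable representative `d'` makes the set of pairs
  -- measurable. A single good `x` then supplies the constant.
  have h2 : ∀ᵐ x, ∀ᵐ s, d' (x + s) = d' x := by
    refine (Measure.ae_ae_comm (p := fun s x => d' (x + s) = d' x) ?_).1 (ae_of_all _ h1)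
    exact measurableSet_eq_fun (by fun_prop) (by fun_prop)
  obtain ⟨x, hx⟩ := h2.exists
  refine ⟨d' x, ?_⟩
  filter_upwards [(measurePreserving_sub_right volume x).quasiMeasurePreserving.ae hx, e]
    with y h1 h2
  rw [h2, ← h1]
  simp

/-- By hypothesis, `w` minus the primitive of `w₁` is invariant under every translation almost
everywhere. -/
theorem exists_eq_add_integral {w w₁ : ℝ → ℝ} (hw : Integrable w) (hw₁ : Integrable w₁)
    (h : ∀ s, ∀ᵐ x, w (x + s) - w x = ∫ r in (0 : ℝ)..s, w₁ (x + r)) :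
    ∃ C, ∀ᵐ x, w x = C + ∫ y in (0 : ℝ)..x, w₁ y := by
  have hc : Continuous fun x => ∫ y in (0 : ℝ)..x, w₁ y :=
    intervalIntegral.continuous_primitive (fun _ _ => hw₁.intervalIntegrable) 0
  obtain ⟨C, hC⟩ := ae_eq_const_of_translation_invariant
    (d := fun x => w x - ∫ y in (0 : ℝ)..x, w₁ y)
    (hw.aestronglyMeasurable.sub hc.aestronglyMeasurable) fun s => by
      filter_upwards [h s] with x hx
      rw [intervalIntegral.integral_comp_add_left, add_zero] at hx
      have := intervalIntegral.integral_add_adjacent_intervals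
        (hw₁.intervalIntegrable (a := 0) (b := x)) (hw₁.intervalIntegrable (a := x) (b := x + s))
      linarith
  refine ⟨C, ?_⟩
  filter_upwards [hC] with x hx
  linarith

/-- An integrable solution of `ζ'' = 2 ζ` on the half-line, in integrated form, is a multiple of the
decaying exponential. -/
theorem ae_eq_exp_of_integral_eq {ζ : ℝ → ℝ} (hζ : Integrable ζ) {A D : ℝ}
    (h : ∀ᵐ x, 0 < x → ζ x = A + D * x + ∫ y in (0 : ℝ)..x, (x - y) * (2 * ζ y)) :
    D = -√2 * A ∧ ∀ᵐ x, 0 < x → ζ x = A * Real.exp (-√2 * x) := by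
  have h2 : Integrable fun y => 2 * ζ y := hζ.const_mul 2
  set V : ℝ → ℝ := fun x => D + ∫ y in (0 : ℝ)..x, 2 * ζ y with hV
  set Z : ℝ → ℝ := fun x => A + ∫ y in (0 : ℝ)..x, V y with hZ
  have cP : Continuous fun x => ∫ y in (0 : ℝ)..x, 2 * ζ y :=
    intervalIntegral.continuous_primitive (fun _ _ => h2.intervalIntegrable) 0
  have cV : Continuous V := continuous_const.add cP
  have dZ : ∀ x, HasDerivAt Z (V x) x := fun x =>
    (cV.integral_hasStrictDerivAt 0 x).hasDerivAt.const_add A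
  have cZ : Continuous Z := continuous_iff_continuousAt.2 fun x => (dZ x).continuousAt
  have eZ : ∀ x, Z x = A + D * x + ∫ y in (0 : ℝ)..x, (x - y) * (2 * ζ y) := fun x => by
    rw [hZ, ← integral_integral_eq h2, hV]
    simp only
    rw [intervalIntegral.integral_add (by simp)
      (cP.intervalIntegrable _ _)]
    simp only [intervalIntegral.integral_const, sub_zero, smul_eq_mul]
    ring
  have hZζ : ∀ᵐ x, 0 < x → ζ x = Z x := by
    filter_upwards [h] with x hx h0
    rw [hx h0, eZ]
  have eV : ∀ x ∈ Ici (0 : ℝ), V x = D + ∫ y in (0 : ℝ)..x, 2 * Z y := fun x hx => by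
    simp only [hV]
    congr 1
    refine intervalIntegral.integral_congr_ae ?_
    filter_upwards [hZζ] with y hy hy2
    rw [uIoc_of_le (mem_Ici.1 hx)] at hy2
    rw [hy hy2.1]
  have dV : ∀ x, 0 ≤ x → HasDerivWithinAt V (2 * Z x) (Ici 0) x := fun x hx =>
    (((by fun_prop : Continuous fun y => 2 * Z y).integral_hasStrictDerivAt 0
      x).hasDerivAt.const_add D).hasDerivWithinAt.congr eV (eV x hx)
  -- Otherwise `|ζ| ≥ 1` almost everywhere on a half-line, a set of infinite measure, against
  -- integrability.
  have nb : ¬ Tendsto (fun x => |Z x|) atTop atTop := by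
    intro ht
    obtain ⟨N, hN⟩ := eventually_atTop.1 (ht.eventually_ge_atTop 1)
    have h3 := hζ.measure_norm_ge_lt_top one_pos
    have h4 : (Ioi (max N 0) : Set ℝ) ≤ᵐ[volume] {x | 1 ≤ ‖ζ x‖} := by
      filter_upwards [hZζ] with x hx hx2
      have hx3 : max N 0 < x := hx2
      rw [max_lt_iff] at hx3
      change 1 ≤ ‖ζ x‖
      rw [hx hx3.2]
      exact hN x hx3.1.le
    have := (measure_mono_ae h4).trans_lt h3
    simp at this
  have key := eq_exp_of_deriv_deriv_eq (fun x _ => (dZ x).hasDerivWithinAt) dV nb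
  have z0 : Z 0 = A := by simp [hZ]
  have v0 : V 0 = D := by simp [hV]
  rw [z0, v0] at key
  refine ⟨key.1, ?_⟩
  filter_upwards [hZζ] with x hx h0
  rw [hx h0, key.2 x h0.le]

end IntegrableFunctions

/-! ### Translations, reflection and the skew group in `L¹(ℝ)` -/

section IntegrableSpace

/-- The space `L¹(ℝ)`. -/
noncomputable abbrev L1R := Lp ℝ 1 (volume : Measure ℝ)

theorem integrable_coe (φ : L1R) : Integrable φ := L1.integrable_coeFn φ

theorem ae_neg {P : ℝ → Prop} (h : ∀ᵐ x : ℝ, P x) : ∀ᵐ x : ℝ, P (-x) :=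
  (Measure.measurePreserving_neg volume).quasiMeasurePreserving.ae h

theorem ae_add_right {P : ℝ → Prop} (h : ∀ᵐ x : ℝ, P x) (s : ℝ) : ∀ᵐ x : ℝ, P (x + s) :=
  (measurePreserving_add_right volume s).quasiMeasurePreserving.ae h

/-- Translation by `s`. -/
noncomputable def translL1 (s : ℝ) : L1R →L[ℝ] L1R :=
  (Lp.compMeasurePreservingₗᵢ ℝ (fun x : ℝ => x + s)
    (measurePreserving_add_right volume s)).toContinuousLinearMap

theorem translL1_coe (s : ℝ) (φ : L1R) : translL1 s φ =ᵐ[volume] fun x => φ (x + s) :=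
  Lp.coeFn_compMeasurePreserving φ (measurePreserving_add_right volume s)

/-- Reflection at `0`. -/
noncomputable def reflL1 : L1R →L[ℝ] L1R :=
  (Lp.compMeasurePreservingₗᵢ ℝ (fun x : ℝ => -x)
    (Measure.measurePreserving_neg volume)).toContinuousLinearMap

theorem reflL1_coe (φ : L1R) : reflL1 φ =ᵐ[volume] fun x => φ (-x) :=
  Lp.coeFn_compMeasurePreserving φ (Measure.measurePreserving_neg volume)

/-- Multiplication by the sign function. -/
noncomputable def signL1 : L1R →L[ℝ] L1R :=
  LinearMap.mkContinuous
    { toFun := fun φ => (Integrable.sgn_mul (integrable_coe φ)).toL1 _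
      map_add' := fun φ ψ => by
        rw [← Integrable.toL1_add, Integrable.toL1_eq_toL1_iff]
        filter_upwards [Lp.coeFn_add φ ψ] with x hx
        rw [hx]
        simp only [Pi.add_apply]
        ring
      map_smul' := fun c φ => by
        rw [RingHom.id_apply, ← Integrable.toL1_smul', Integrable.toL1_eq_toL1_iff]
        filter_upwards [Lp.coeFn_smul c φ] with x hx
        rw [hx]
        simp only [Pi.smul_apply, smul_eq_mul]
        ring } 1 fun φ => by
    rw [one_mul]
    refine Lp.norm_le_norm_of_ae_le ?_
    filter_upwards [Integrable.coeFn_toL1 (Integrable.sgn_mul (integrable_coe φ))] with x hx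
    have : ((Integrable.sgn_mul (integrable_coe φ)).toL1 _) x = sgn x * φ x := hx
    refine (congrArg norm this).le.trans ?_
    rw [norm_mul]
    exact mul_le_of_le_one_left (norm_nonneg _) (norm_sgn_le x)

theorem signL1_coe (φ : L1R) : signL1 φ =ᵐ[volume] fun x => sgn x * φ x :=
  Integrable.coeFn_toL1 (Integrable.sgn_mul (integrable_coe φ))

/-- The change of variables that turns the heat semigroup into the skew semigroup in `L¹`. -/
noncomputable def skewL1 (k : ℝ) : L1R →L[ℝ] L1R :=
  ContinuousLinearMap.id ℝ L1R + k • signL1.comp (ContinuousLinearMap.id ℝ L1R + reflL1)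

theorem skewL1_coe (k : ℝ) (φ : L1R) :
    skewL1 k φ =ᵐ[volume] fun x => φ x + k * sgn x * (φ x + φ (-x)) := by
  have e : skewL1 k φ = φ + k • signL1 (φ + reflL1 φ) := rfl
  rw [e]
  filter_upwards [Lp.coeFn_add φ (k • signL1 (φ + reflL1 φ)),
    Lp.coeFn_smul k (signL1 (φ + reflL1 φ)), signL1_coe (φ + reflL1 φ),
    Lp.coeFn_add φ (reflL1 φ), reflL1_coe φ] with x h1 h2 h3 h4 h5
  rw [h1, Pi.add_apply, h2, Pi.smul_apply, h3, h4, Pi.add_apply, h5, smul_eq_mul]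
  ring

/-- The perturbation `sgn · (φ + φ(-·))` is odd almost everywhere, and adding an odd function to its
reflection gives zero. -/
theorem skewL1_comp_neg (k : ℝ) :
    (skewL1 k).comp (skewL1 (-k)) = ContinuousLinearMap.id ℝ L1R := by
  refine ContinuousLinearMap.ext fun φ => Lp.ext ?_
  change skewL1 k (skewL1 (-k) φ) =ᵐ[volume] φ
  filter_upwards [skewL1_coe k (skewL1 (-k) φ), skewL1_coe (-k) φ, ae_neg (skewL1_coe (-k) φ),
    ae_ne_zero] with x h1 h2 h3 h4
  rw [h1, h2, h3, sgn_neg h4, neg_neg]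
  ring

theorem skewL1_skewL1_neg (k : ℝ) (φ : L1R) : skewL1 k (skewL1 (-k) φ) = φ :=
  congrArg (fun L => L φ) (skewL1_comp_neg k)

theorem skewL1_neg_skewL1 (k : ℝ) (φ : L1R) : skewL1 (-k) (skewL1 k φ) = φ := by
  simpa using skewL1_skewL1_neg (-k) φ

theorem isBoundedGroup_translL1 : IsBoundedGroup translL1 1 where
  zero := by
    refine ContinuousLinearMap.ext fun φ => Lp.ext ?_
    filter_upwards [translL1_coe 0 φ] with x hx
    rw [hx, add_zero]
    rfl
  add s t := by
    refine ContinuousLinearMap.ext fun φ => Lp.ext ?_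
    change translL1 (s + t) φ =ᵐ[volume] translL1 s (translL1 t φ)
    filter_upwards [translL1_coe (s + t) φ, translL1_coe s (translL1 t φ),
      ae_add_right (translL1_coe t φ) s] with x h1 h2 h3
    rw [h1, h2, h3, add_assoc]
  bound s := LinearIsometry.norm_toContinuousLinearMap_le _
  cont φ := by
    have hg : Continuous fun s : ℝ => (⟨fun x : ℝ => x + s, by fun_prop⟩ : C(ℝ, ℝ)) :=
      ContinuousMap.continuous_of_continuous_uncurry _ (by
        change Continuous fun p : ℝ × ℝ => p.2 + p.1
        fun_prop)
    exact (continuous_const (y := φ)).compMeasurePreservingLp hg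
      (fun s => measurePreserving_add_right volume s) (by simp)

/-- The group that generates the skew semigroup in `L¹`. -/
noncomputable def groupL1 (k s : ℝ) : L1R →L[ℝ] L1R :=
  (skewL1 (-k)).comp ((translL1 s).comp (skewL1 k))

theorem isBoundedGroup_groupL1 (k : ℝ) :
    IsBoundedGroup (groupL1 k) (‖skewL1 (-k)‖ * (1 * ‖skewL1 k‖)) :=
  isBoundedGroup_translL1.conj (by simpa using skewL1_comp_neg (-k)) (skewL1_comp_neg k)

theorem skewL1_groupL1 (k s : ℝ) (φ : L1R) :
    skewL1 k (groupL1 k s φ) = translL1 s (skewL1 k φ) := skewL1_skewL1_neg k _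

/-- Integration over `A`. -/
noncomputable def setIntegralL1 (A : Set ℝ) : L1R →L[ℝ] ℝ :=
  LinearMap.mkContinuous
    { toFun := fun φ => ∫ x in A, φ x
      map_add' := fun φ ψ => by
        rw [integral_congr_ae (ae_restrict_of_ae (Lp.coeFn_add φ ψ))]
        exact integral_add (integrable_coe φ).integrableOn (integrable_coe ψ).integrableOn
      map_smul' := fun c φ => by
        rw [integral_congr_ae (ae_restrict_of_ae (Lp.coeFn_smul c φ))]
        exact integral_const_mul _ _ } 1 fun φ => by
    rw [one_mul, L1.norm_eq_integral_norm]
    exact (norm_integral_le_integral_norm _).trans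
      (setIntegral_le_integral (integrable_coe φ).norm (ae_of_all _ fun _ => norm_nonneg _))

theorem setIntegralL1_apply (A : Set ℝ) (φ : L1R) : setIntegralL1 A φ = ∫ x in A, φ x := rfl

/-- The `L¹`-valued average of translates is computed pointwise. -/
theorem integral_translL1_coe {κ : ℝ → ℝ} (hκ : Integrable κ) (φ : L1R) :
    (∫ y, κ y • translL1 y φ : L1R) =ᵐ[volume] fun x => ∫ y, κ y * φ (x + y) := by
  have H : Integrable (fun z : ℝ × ℝ => κ z.1 * φ (z.2 + z.1)) (volume.prod volume) := by
    have := (measurePreserving_prod_add (volume : Measure ℝ)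
      (volume : Measure ℝ)).integrable_comp_of_integrable
      (hκ.mul_prod (integrable_coe φ))
    simpa [Function.comp_def, add_comm] using this
  -- Compare integrals over a set `A`: integration over `A` is a continuous functional, so it passes
  -- under the vector-valued integral, and Fubini does the rest.
  refine Integrable.ae_eq_of_forall_setIntegral_eq _ _ (integrable_coe _) H.integral_prod_right
    fun A hA _ => ?_
  have H' : Integrable (fun z : ℝ × ℝ => κ z.1 * φ (z.2 + z.1))
      (volume.prod (volume.restrict A)) := by
    have := H.restrict (s := univ ×ˢ A)
    rwa [← Measure.prod_restrict, Measure.restrict_univ] at this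
  rw [← setIntegralL1_apply, ← (setIntegralL1 A).integral_comp_comm
    (isBoundedGroup_translL1.integrable_smul hκ φ), ← integral_integral_swap H']
  refine integral_congr_ae (ae_of_all _ fun y => ?_)
  simp only [map_smul, smul_eq_mul]
  rw [integral_const_mul, setIntegralL1_apply]
  congr 1
  exact integral_congr_ae (ae_restrict_of_ae (translL1_coe y φ))

theorem intervalIntegral_translL1_coe (s : ℝ) (φ : L1R) :
    (∫ r in (0 : ℝ)..s, translL1 r φ : L1R) =ᵐ[volume] fun x => ∫ r in (0 : ℝ)..s, φ (x + r) := by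
  -- An oriented interval integral is an integral against a signed indicator, so the previous
  -- formula applies.
  have hκ : Integrable ((uIoc 0 s).indicator fun _ => if (0 : ℝ) ≤ s then (1 : ℝ) else -1) :=
    (integrable_indicator_iff measurableSet_uIoc).2 (integrableOn_const (by simp [uIoc]))
  have h := integral_translL1_coe hκ φ
  have e : ∀ {E : Type} [NormedAddCommGroup E] [NormedSpace ℝ E] (F : ℝ → E),
      ∫ r in (0 : ℝ)..s, F r =
        ∫ r, ((uIoc 0 s).indicator (fun _ => if (0 : ℝ) ≤ s then (1 : ℝ) else -1) r) • F r := by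
    intro E _ _ F
    rw [intervalIntegral.intervalIntegral_eq_integral_uIoc, ← integral_smul,
      ← integral_indicator measurableSet_uIoc]
    congr 1
    ext r
    by_cases hr : r ∈ uIoc 0 s <;> simp [hr]
  rw [e]
  simp only [e]
  exact h

theorem exists_eq_add_integral_of_hasDerivAt {w w₁ : L1R}
    (h : ∀ s, HasDerivAt (fun s => translL1 s w) (translL1 s w₁) s) :
    ∃ C, ∀ᵐ x, w x = C + ∫ y in (0 : ℝ)..x, w₁ y := by
  refine exists_eq_add_integral (integrable_coe w) (integrable_coe w₁) fun s => ?_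
  have h1 : ∫ r in (0 : ℝ)..s, translL1 r w₁ = translL1 s w - w := by
    rw [intervalIntegral.integral_eq_sub_of_hasDerivAt (fun x _ => h x)
      ((isBoundedGroup_translL1.cont w₁).intervalIntegrable 0 s),
      isBoundedGroup_translL1.zero_apply]
  have h2 := intervalIntegral_translL1_coe s w₁
  rw [h1] at h2
  filter_upwards [h2, Lp.coeFn_sub (translL1 s w) w, translL1_coe s w] with x a b c
  rw [← a, b, Pi.sub_apply, c]

theorem exists_eq_integral_sub_mul {w w₁ u : L1R}
    (h₁ : ∀ s, HasDerivAt (fun s => translL1 s w) (translL1 s w₁) s)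
    (h₂ : ∀ s, HasDerivAt (fun s => translL1 s w₁) (translL1 s u) s) :
    ∃ C D, ∀ᵐ x, w x = C + D * x + ∫ y in (0 : ℝ)..x, (x - y) * u y := by
  obtain ⟨C, hC⟩ := exists_eq_add_integral_of_hasDerivAt h₁
  obtain ⟨D, hD⟩ := exists_eq_add_integral_of_hasDerivAt h₂
  refine ⟨C, D, ?_⟩
  filter_upwards [hC] with x hx
  have hc : Continuous fun x => ∫ y in (0 : ℝ)..x, u y :=
    intervalIntegral.continuous_primitive (fun _ _ => (integrable_coe u).intervalIntegrable) 0
  rw [hx, intervalIntegral.integral_congr_ae (g := fun y => D + ∫ r in (0 : ℝ)..y, u r)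
    (by filter_upwards [hD] with y hy _ using hy),
    intervalIntegral.integral_add (by simp) (hc.intervalIntegrable _ _),
    integral_integral_eq (integrable_coe u)]
  simp only [intervalIntegral.integral_const, sub_zero, smul_eq_mul]
  ring

end IntegrableSpace

/-! ### The generator and the kernel representation in `L¹(ℝ)` -/

section IntegrableGenerator

variable {p q : ℝ}

theorem delta_of_hasDerivAt (hpq : p + q ≠ 0) {w w₁ u : L1R}
    (h₁ : ∀ s, HasDerivAt (fun s => groupL1 ((q - p) / (2 * (p + q))) s w)
      (groupL1 ((q - p) / (2 * (p + q))) s w₁) s)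
    (h₂ : ∀ s, HasDerivAt (fun s => groupL1 ((q - p) / (2 * (p + q))) s w₁)
      (groupL1 ((q - p) / (2 * (p + q))) s u) s) : Delta p q w u := by
  set k := (q - p) / (2 * (p + q)) with hk
  have red : ∀ {a b : L1R}, (∀ s, HasDerivAt (fun s => groupL1 k s a) (groupL1 k s b) s) →
      ∀ s, HasDerivAt (fun s => translL1 s (skewL1 k a)) (translL1 s (skewL1 k b)) s := by
    intro a b h s
    have := (skewL1 k).hasFDerivAt.comp_hasDerivAt s (h s)
    simpa only [Function.comp_def, skewL1_groupL1] using this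
  obtain ⟨C, D, h⟩ := exists_eq_integral_sub_mul (red h₁) (red h₂)
  have ew := skewL1_coe (-k) (skewL1 k w)
  have eu := skewL1_coe (-k) (skewL1 k u)
  rw [skewL1_neg_skewL1] at ew eu
  set m : L1R := skewL1 k u with hm
  have im := integrable_coe m
  have imn : Integrable fun y => m (-y) := im.comp_neg
  have e₀ : ∀ x, ∫ y in (0 : ℝ)..-x, (-x - y) * m y = ∫ y in (0 : ℝ)..x, (x - y) * m (-y) := by
    intro x
    have := intervalIntegral.integral_comp_neg (a := 0) (b := x) (fun y => (-x - y) * m y)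
    rw [neg_zero] at this
    rw [intervalIntegral.integral_symm (-x) 0, ← this, ← intervalIntegral.integral_neg]
    congr 1
    ext y
    ring
  have eR : ∀ x a b, a * (∫ y in (0 : ℝ)..x, (x - y) * m y) +
      b * (∫ y in (0 : ℝ)..x, (x - y) * m (-y)) =
        ∫ y in (0 : ℝ)..x, (x - y) * (a * m y + b * m (-y)) := by
    intro x a b
    rw [← intervalIntegral.integral_const_mul, ← intervalIntegral.integral_const_mul,
      ← intervalIntegral.integral_add ((intervalIntegrable_sub_mul im x 0 x).const_mul a)
        ((intervalIntegrable_sub_mul imn x 0 x).const_mul b)]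
    congr 1
    ext y
    ring
  -- The transformed function `skewL1 k w` has no jump and constant term `C`. Undoing the
  -- transformation multiplies this term by `1 + 2k = 2q/(p + q)` on the left and by `1 - 2k = 2p/(p
  -- + q)` on the right, and leaves the slope `D` unchanged.
  refine ⟨2 / (p + q) * C, D, ?_, ?_⟩
  · filter_upwards [ew, h, ae_neg h] with x h1 h2 h3 hx
    have e : -∫ y in x..0, (x - y) * u y =
        ∫ y in (0 : ℝ)..x, (x - y) * ((1 + k) * m y + k * m (-y)) := by
      rw [← intervalIntegral.integral_symm]
      refine intervalIntegral.integral_congr_ae ?_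
      filter_upwards [eu] with y hy hy2
      rw [uIoc_of_ge hx.le] at hy2
      rw [hy, sgn_of_nonpos hy2.2]
      ring
    have e2 : q * (2 / (p + q) * C) = (1 + 2 * k) * C := by
      rw [hk]
      field_simp
      ring
    rw [sub_eq_add_neg, e, e2, ← eR, h1, h2, h3, e₀, sgn_of_nonpos hx.le]
    ring
  · filter_upwards [ew, h, ae_neg h] with x h1 h2 h3 hx
    have e : ∫ y in (0 : ℝ)..x, (x - y) * u y =
        ∫ y in (0 : ℝ)..x, (x - y) * ((1 - k) * m y + -k * m (-y)) := by
      refine intervalIntegral.integral_congr_ae ?_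
      filter_upwards [eu] with y hy hy2
      rw [uIoc_of_le hx.le] at hy2
      rw [hy, sgn_of_pos hy2.1]
      ring
    have e2 : p * (2 / (p + q) * C) = (1 - 2 * k) * C := by
      rw [hk]
      field_simp
      ring
    rw [e, e2, ← eR, h1, h2, h3, e₀, sgn_of_pos hx]
    ring

theorem Delta.sub {v u v' u' : L1R} (h : Delta p q v u) (h' : Delta p q v' u') :
    Delta p q (v - v') (u - u') := by
  obtain ⟨C, D, a1, a2⟩ := h
  obtain ⟨C', D', b1, b2⟩ := h'
  have e : ∀ x a b, ∫ y in a..b, (x - y) * (u - u' : L1R) y =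
      (∫ y in a..b, (x - y) * u y) - ∫ y in a..b, (x - y) * u' y := by
    intro x a b
    rw [← intervalIntegral.integral_sub (intervalIntegrable_sub_mul (integrable_coe u) x a b)
      (intervalIntegrable_sub_mul (integrable_coe u') x a b)]
    refine intervalIntegral.integral_congr_ae ?_
    filter_upwards [Lp.coeFn_sub u u'] with y hy _
    rw [hy, Pi.sub_apply]
    ring
  refine ⟨C - C', D - D', ?_, ?_⟩
  · filter_upwards [a1, b1, Lp.coeFn_sub v v'] with x h1 h2 h3 hx
    rw [h3, Pi.sub_apply, h1 hx, h2 hx, e]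
    ring
  · filter_upwards [a2, b2, Lp.coeFn_sub v v'] with x h1 h2 h3 hx
    rw [h3, Pi.sub_apply, h1 hx, h2 hx, e]
    ring

theorem Delta.eq_zero (hpq : p + q ≠ 0) {z : L1R} (h : Delta p q z ((2 : ℝ) • z)) : z = 0 := by
  obtain ⟨C, D, h₁, h₂⟩ := h
  have e : ((2 : ℝ) • z : L1R) =ᵐ[volume] fun y => 2 * z y := by
    filter_upwards [Lp.coeFn_smul (2 : ℝ) z] with y hy
    rw [hy, Pi.smul_apply, smul_eq_mul]
  have e' : ∀ x a b, ∫ y in a..b, (x - y) * ((2 : ℝ) • z : L1R) y =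
      ∫ y in a..b, (x - y) * (2 * z y) := by
    intro x a b
    refine intervalIntegral.integral_congr_ae ?_
    filter_upwards [e] with y hy _
    rw [hy]
  simp only [e'] at h₁ h₂
  obtain ⟨r1, r2⟩ := ae_eq_exp_of_integral_eq (integrable_coe z) h₂
  obtain ⟨l1, l2⟩ := ae_eq_exp_of_integral_eq (ζ := fun x => z (-x)) (A := q * C) (D := -D)
    (integrable_coe z).comp_neg (by
      filter_upwards [ae_neg h₁] with x hx h0
      have := intervalIntegral.integral_comp_neg (a := 0) (b := x)
        (fun y => (-x - y) * (2 * z y))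
      rw [neg_zero] at this
      rw [hx (by linarith), ← this, sub_eq_add_neg, ← intervalIntegral.integral_neg]
      congr 1
      · ring
      · congr 1
        ext y
        ring)
  -- The two half-lines give `D = -√2 p C` and `-D = -√2 q C`; the sum is `(p + q) √2 C = 0`.
  have hC : C = 0 := by
    have : (p + q) * (√2 * C) = 0 := by linarith
    simpa [hpq] using this
  refine Lp.ext ?_
  filter_upwards [r2, ae_neg l2, ae_ne_zero, Lp.coeFn_zero ℝ 1 (volume : Measure ℝ)]
    with x a b c d
  rw [d, Pi.zero_apply]
  rcases lt_or_gt_of_ne c with hx | hx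
  · simpa [hC] using b (by linarith)
  · simpa [hC] using a hx

theorem isGeneratedBy_delta (hpq : p + q ≠ 0) :
    IsGeneratedBy (isBoundedGroup_groupL1 ((q - p) / (2 * (p + q)))).gaussian
      (Half (Delta p q)) ∧ ∀ v, ∃ w, Half (Delta p q) w (w - v) :=
  IsBoundedGroup.isGeneratedBy_gaussian _ (fun _ _ _ => delta_of_hasDerivAt hpq)
    (fun _ _ _ _ => Delta.sub) fun _ => Delta.eq_zero hpq

theorem gaussian_groupL1_eq (k : ℝ) {t : ℝ} (ht : 0 < t) (φ : L1R) :
    (isBoundedGroup_groupL1 k).gaussian t φ =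
      skewL1 (-k) (∫ s, heatKernel t s • translL1 s (skewL1 k φ)) := by
  rw [IsBoundedGroup.gaussian_apply, integral_gaussianReal_eq ht,
    ← (skewL1 (-k)).integral_comp_comm
      (isBoundedGroup_translL1.integrable_smul (integrable_heatKernel ht) _)]
  simp only [map_smul]
  rfl

theorem integrable_heatKernel_mul {t : ℝ} (ht : 0 < t) {f : ℝ → ℝ} (hf : Integrable f) (c : ℝ) :
    Integrable fun x => heatKernel t (x - c) * f x :=
  hf.bdd_mul ((continuous_heatKernel t).comp (by fun_prop)).aestronglyMeasurable
    (ae_of_all _ fun x => by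
      rw [Real.norm_of_nonneg (heatKernel_nonneg _ _)]
      exact heatKernel_le t _ ht)

theorem gaussian_groupL1_apply (k : ℝ) {t : ℝ} (ht : 0 < t) (φ : L1R) : ∀ᵐ y : ℝ,
    Integrable (fun x => skewKernel k t x y * φ x) ∧
      (isBoundedGroup_groupL1 k).gaussian t φ y = ∫ x, skewKernel k t x y * φ x := by
  set θ : L1R := skewL1 k φ with hθ
  have h1 := integral_translL1_coe (integrable_heatKernel ht) θ
  rw [gaussian_groupL1_eq k ht]
  set Q : L1R := ∫ s, heatKernel t s • translL1 s θ with hQ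
  have h2 : ∀ᵐ y, Q y = ∫ x, heatKernel t (x - y) * θ x := by
    filter_upwards [h1] with y hy
    rw [hy, ← integral_sub_right_eq_self (fun x => heatKernel t x * θ (y + x)) y]
    simp
  have iθ := integrable_coe θ
  have iφ := integrable_coe φ
  filter_upwards [skewL1_coe (-k) Q, h2, ae_neg h2] with y a b c
  -- Now the outer skew operator acts in `y`, the variable that stays fixed, and the inner one is
  -- transposed in `x`. The result is the same `skewKernel`, integrated over its starting point.
  set K : ℝ → ℝ := fun x => (1 - k * sgn y) * heatKernel t (x - y) -
    k * sgn y * heatKernel t (x + y) with hK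
  have iK : ∀ {f : ℝ → ℝ}, Integrable f → Integrable fun x => K x * f x := by
    intro f hf
    refine (((integrable_heatKernel_mul ht hf y).const_mul (1 - k * sgn y)).sub
      ((integrable_heatKernel_mul ht hf (-y)).const_mul (k * sgn y))).congr
        (ae_of_all _ fun x => ?_)
    simp only [Pi.sub_apply, hK, sub_neg_eq_add]
    ring
  have iK' : Integrable fun x => K (-x) * φ x := by
    simpa using (iK (iφ.comp_neg)).comp_neg
  have e1 : skewL1 (-k) Q y = ∫ x, K x * θ x := by
    rw [a, b, c]
    have : ∀ x, K x * θ x = (1 - k * sgn y) * (heatKernel t (x - y) * θ x) -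
        k * sgn y * (heatKernel t (x - -y) * θ x) := fun x => by
      simp only [hK, sub_neg_eq_add]
      ring
    simp only [this]
    rw [integral_sub ((integrable_heatKernel_mul ht iθ y).const_mul _)
      ((integrable_heatKernel_mul ht iθ (-y)).const_mul _), integral_const_mul, integral_const_mul]
    ring
  have h3 := integral_mul_fold (K := K) (f := φ) k k (iK iφ) iK'
  have e2 : ∫ x, K x * θ x = ∫ x, K x * (φ x + k * sgn x * φ x + k * sgn x * φ (-x)) := by
    refine integral_congr_ae ?_
    filter_upwards [skewL1_coe k φ] with x hx
    rw [hθ, hx]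
    ring
  have e3 : ∀ x, K x * (1 + k * sgn x) - k * sgn x * K (-x) = skewKernel k t x y := by
    intro x
    have b1 : heatKernel t (-x - y) = heatKernel t (y + x) := by
      rw [← heatKernel_neg, neg_sub, sub_neg_eq_add]
    have b2 : heatKernel t (-x + y) = heatKernel t (y - x) := by
      rw [neg_add_eq_sub]
    have b3 : heatKernel t (x - y) = heatKernel t (y - x) := by
      rw [← heatKernel_neg, neg_sub]
    simp only [hK, skewKernel, b1, b2, b3, add_comm x y]
    ring
  simp only [e3] at h3
  exact ⟨h3.1, by rw [e1, e2, h3.2]⟩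

theorem gaussian_groupL1_apply_gamma (hpq : p + q ≠ 0) {t : ℝ} (ht : 0 < t) (φ : L1R) :
    ∀ᵐ y : ℝ, Integrable (fun x => gamma p q t x y * φ x) ∧
      (isBoundedGroup_groupL1 ((q - p) / (2 * (p + q)))).gaussian t φ y =
        ∫ x, gamma p q t x y * φ x := by
  filter_upwards [gaussian_groupL1_apply ((q - p) / (2 * (p + q))) ht φ, ae_ne_zero] with y h hy
  have e : (fun x => gamma p q t x y * φ x) =ᵐ[volume]
      fun x => skewKernel ((q - p) / (2 * (p + q))) t x y * φ x := by
    filter_upwards [ae_ne_zero] with x hx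
    rw [gamma_eq hpq t hx hy]
  exact ⟨h.1.congr e.symm, h.2.trans (integral_congr_ae e).symm⟩

end IntegrableGenerator

end SkewDiffusion

/-! ### Transfer to arbitrary semigroups with the given generators -/

theorem mainTheorem6 (p q : ℝ) (hp : 0 ≤ p) (hq : 0 ≤ q) (hpq : 0 < p + q) :
    -- the two semigroups exist
    (∃ S : ℝ → CBar →L[ℝ] CBar, IsGeneratedBy S (Half (DualDelta p q))) ∧
    (∃ T : ℝ → Lp ℝ 1 (volume : Measure ℝ) →L[ℝ] Lp ℝ 1 (volume : Measure ℝ),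
      IsGeneratedBy T (Half (Delta p q))) ∧
    -- the kernels are probability densities
    (∀ t > 0, ∀ x > 0, (∀ y, 0 ≤ gammaPlus p q t x y) ∧
      Integrable (gammaPlus p q t x) ∧ ∫ y, gammaPlus p q t x y = 1) ∧
    (∀ t > 0, ∀ x < 0, (∀ y, 0 ≤ gammaMinus p q t x y) ∧
      Integrable (gammaMinus p q t x) ∧ ∫ y, gammaMinus p q t x y = 1) ∧
    -- the semigroup on `C[-∞,+∞]`: Weierstrass formula, kernels, transition densities
    (∀ S : ℝ → CBar →L[ℝ] CBar, IsGeneratedBy S (Half (DualDelta p q)) →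
      (∀ t > 0, ∀ f : CBar,
        (∀ x : ℝ,
          IntegrableOn (fun s => Real.exp (-s ^ 2 / (2 * t)) * dualCosine p q s f.1 x) (Ioi 0) ∧
          (S t f).1 x = √(2 / (Real.pi * t)) *
            ∫ s in Ioi (0 : ℝ), Real.exp (-s ^ 2 / (2 * t)) * dualCosine p q s f.1 x) ∧
        (∀ x > 0, Integrable (fun y => gammaPlus p q t x y * f.1 y) ∧
          (S t f).1 x = ∫ y, gammaPlus p q t x y * f.1 y) ∧
        (∀ x < 0, Integrable (fun y => gammaMinus p q t x y * f.1 y) ∧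
          (S t f).1 x = ∫ y, gammaMinus p q t x y * f.1 y)) ∧
      (∀ (Ω : Type*) [MeasurableSpace Ω] (P : ℝ → Measure Ω) (w : ℝ → Ω → ℝ),
        IsMarkovProcess S P w → ∀ t > 0,
          (∀ x > 0, (P x).map (w t) =
            volume.withDensity fun y => ENNReal.ofReal (gammaPlus p q t x y)) ∧
          (∀ x < 0, (P x).map (w t) =
            volume.withDensity fun y => ENNReal.ofReal (gammaMinus p q t x y)))) ∧
    -- the semigroup on `L¹(ℝ)` evolves densities through the same kernels
    (∀ T : ℝ → Lp ℝ 1 (volume : Measure ℝ) →L[ℝ] Lp ℝ 1 (volume : Measure ℝ),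
      IsGeneratedBy T (Half (Delta p q)) →
      ∀ t > 0, ∀ φ : Lp ℝ 1 (volume : Measure ℝ), ∀ᵐ y : ℝ,
        Integrable (fun x => gamma p q t x y * φ x) ∧
        T t φ y = ∫ x, gamma p q t x y * φ x) := by
  have hpq' : p + q ≠ 0 := hpq.ne'
  obtain ⟨hS₀, hS₁⟩ := isGeneratedBy_dualDelta hpq'
  obtain ⟨hT₀, hT₁⟩ := isGeneratedBy_delta hpq'
  refine ⟨⟨_, hS₀⟩, ⟨_, hT₀⟩,
    fun t ht x hx => ⟨gammaPlus_nonneg hp hq hpq ht hx, integral_gammaPlus hpq' ht hx⟩,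
    fun t ht x hx => ⟨gammaMinus_nonneg hp hq hpq ht hx, integral_gammaMinus hpq' ht hx⟩,
    fun S hS => ?_, fun T hT t ht φ => ?_⟩
  -- No bound on `S` is needed: boundedness of the Gaussian semigroup alone gives uniqueness.
  · have hSt : ∀ t > 0, S t = _ := fun t ht =>
      hS₀.eq_of_bounded hS (fun t _ => IsBoundedGroup.norm_gaussian_le _ t) hS₁ ht.le
    refine ⟨fun t ht f => ?_, fun Ω _ P w h t ht => ⟨fun x hx => ?_, fun x hx => ?_⟩⟩
    · rw [hSt t ht]
      exact ⟨weierstrass_formula p q ht f, fun x hx => integrable_gammaPlus_mul hpq' ht hx f,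
        fun x hx => integrable_gammaMinus_mul hpq' ht hx f⟩
    · refine h.map_eq_withDensity ht.le x (gammaPlus_nonneg hp hq hpq ht hx)
        (integral_gammaPlus hpq' ht hx).1 fun f => ?_
      rw [hSt t ht]
      exact (integrable_gammaPlus_mul hpq' ht hx f).2
    · refine h.map_eq_withDensity ht.le x (gammaMinus_nonneg hp hq hpq ht hx)
        (integral_gammaMinus hpq' ht hx).1 fun f => ?_
      rw [hSt t ht]
      exact (integrable_gammaMinus_mul hpq' ht hx f).2
  · rw [hT₀.eq_of_bounded hT (fun t _ => IsBoundedGroup.norm_gaussian_le _ t) hT₁ ht.le]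
    exact gaussian_groupL1_apply_gamma hpq' ht φ
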